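/- **Setting.** A two-player zero-sum Markov game has a horizon $H$, a measurable state space $\mathcal S$, finite nonempty action sets $\mathcal A_1,\mathcal A_2$, deterministic rewards $r_h(s,a,b)\in[0,1]$ and transition kernels $\mathbb P_h(\cdot\mid s,a,b)$, $h\in[H]$. For Markov policies $\pi$ (max-player) and $\nu$ (min-player), $V_h^{\pi,\nu}(s)=\mathbb E_{\pi,\nu}\big[\sum_{k=h}^H r_k(s_k,a_k,b_k)\mid s_h=s\big]$. The pair $(\pi^*,\nu^*)$ is a Nash equilibrium (NE) if $V_h^{\pi,\nu^*}(s)\le V_h^{\pi^*,\nu^*}(s)\le V_h^{\pi^*,\nu}(s)$ for all $\pi,\nu,h,s$. The duality gap of $(\pi,\nu)$ at $x$ is $\mathrm{SubOpt}((\pi,\nu),x)=\sup_{\pi_1}V_1^{\pi_1,\nu}(x)-\inf_{\nu_1}V_1^{\pi,\nu_1}(x)$. The game is *linear* with known measurable feature map $\phi:\mathcal S\times\mathcal A_1\times\mathcal A_2\to\mathbb R^d$, $\|\phi\|_2\le1$, if for every $h$ there are a vector $\theta_h\in\mathbb R^d$ and a vector $\mu_h=(\mu_h^{(i)})_{i\le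 d}$ of signed measures on $\mathcal S$ with $r_h=\phi^\top\theta_h$, $\mathbb P_h(\cdot\mid s,a,b)=\phi(s,a,b)^\top\mu_h(\cdot)$, $\|\theta_h\|_2\le\sqrt d$ and $\big\|(|\mu_h^{(i)}|(\mathcal S))_{i\le d}\big\|_2\le\sqrt d$, where $|\cdot|$ denotes total variation. A random dataset $\mathcal D=\{(s_h^\tau,a_h^\tau,b_h^\tau,r_h^\tau)\}$ of $K\ge1$ trajectories (with $s_{H+1}^\tau$ the last states) is *compliant* if for all $h\in[H]$, $\tau\in[K]$, conditionally on $\{(s_h^i,a_h^i,b_h^i)\}_{i\le\tau}$ and $\{(r_h^i,s_{h+1}^i)\}_{i<\tau}$, the pair $(r_h^\tau,s_{h+1}^\tau)$ has the law of (reward, next state) of the game at step $h$ from $(s_h^\tau,a_h^\tau,b_h^\tau)$. **Algorithm (PMVI) with parameter $\beta$.** Let $\phi_h^\tau=\phi(s_h^\tau,a_h^\tau,b_h^\tau)$, $\Lambda_h=\sum_\tau\phi_h^\tau(\phi_h^\tau)^\top+I$, $\|v\|_{\Lambda_h^{-1}}=\sqrt{v^\top\Lambda_h^{-1}v}$, $\Pi_m(y)=\min\{m,\max\{y,0\}\}$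 and $\underline V_{H+1}=\overline V_{H+1}=0$. For $h=H,\dots,1$: put $\underline w_h=\Lambda_h^{-1}\sum_\tau\phi_h^\tau(r_h^\tau+\underline V_{h+1}(s_{h+1}^\tau))$ and $\overline w_h=\Lambda_h^{-1}\sum_\tau\phi_h^\tau(r_h^\tau+\overline V_{h+1}(s_{h+1}^\tau))$; put $\underline Q_h=\Pi_{H-h+1}\{\phi^\top\underline w_h-\beta\|\phi\|_{\Lambda_h^{-1}}\}$ and $\overline Q_h=\Pi_{H-h+1}\{\phi^\top\overline w_h+\beta\|\phi\|_{\Lambda_h^{-1}}\}$; at each state $s$ let $(\hat\pi_h,\nu_h')$ and $(\pi_h',\hat\nu_h)$ be Nash equilibria of the matrix games $\underline Q_h(s,\cdot,\cdot)$ and $\overline Q_h(s,\cdot,\cdot)$, chosen measurably in $s$; let $\underline V_h(s)$ and $\overline V_h(s)$ be the corresponding expected payoffs. The output is $(\hat\pi,\hat\nu)$. **Relative uncertainty.** For fixed $\mathcal D$ let $U(\pi,\nu,x)=\sum_{h=1}^H\mathbb E_{\pi,\nu}\big[\|\phi(s_h,a_h,b_h)\|_{\Lambda_h^{-1}}\mid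 s_1=x\big]$, where the expectation is over a trajectory of the game, and $\mathrm{RU}(\mathcal D,x)=\inf_{(\pi^*,\nu^*)\text{ NE}}\max\{\sup_\nu U(\pi^*,\nu,x),\ \sup_\pi U(\pi,\nu^*,x)\}$ (an infimum in $[-\infty,\infty]$). **Theorem.** There is an absolute constant $c_0>0$ such that the following holds for every $c\ge c_0$, every linear two-player zero-sum Markov game, every compliant dataset of $K\ge1$ trajectories and every $p\in(0,1)$. Run PMVI with $\beta=c\,d\,H\sqrt{\log(2dKH/p)}$. Then there is an event of probability at least $1-p$ on which, for all choices of the matrix-game equilibria in PMVI, every $x\in\mathcal S$ and every Nash equilibrium $(\pi^*,\nu^*)$ of the game, $$\mathrm{SubOpt}\big((\hat\pi,\hat\nu),x\big)\le 2\beta\sum_{h=1}^H\mathbb E_{\pi^*,\nu'}\big[\|\phi_h\|_{\Lambda_h^{-1}}\mid s_1=x\big]+2\beta\sum_{h=1}^H\mathbb E_{\pi',\nu^*}\big[\|\phi_h\|_{\Lambda_h^{-1}}\mid s_1=x\big],$$ where $\phi_h=\phi(s_h,a_h,b_h)$; and moreover $\mathrm{SubOpt}\big((\hat\pi,\hat\nu),x\big)\le4\beta\cdot\mathrm{RU}(\mathcal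 D,x)$. -/

import Mathlib

open MeasureTheory ProbabilityTheory
open scoped ProbabilityTheory Matrix

noncomputable section

namespace ZeroSumMG

/-! Steps of an episode are numbered `1, …, H` inside `ℕ`; whatever an object says about
other step numbers is never used. -/

/-- A two-player zero-sum Markov game with horizon `H`, deterministic rewards in `[0, 1]` and
transition kernels `P h (· ∣ s, a, b)`. -/
structure MarkovGame (S A B : Type*) [MeasurableSpace S] [MeasurableSpace A]
    [MeasurableSpace B] where
  /-- number of steps of an episode -/
  H : ℕ
  /-- reward function of each step -/
  reward : ℕ → S × A × B → ℝ
  /-- transition kernel of each step -/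
  P : ℕ → Kernel (S × A × B) S
  reward_measurable : ∀ h, Measurable (reward h)
  reward_mem : ∀ h z, reward h z ∈ Set.Icc (0 : ℝ) 1
  markov : ∀ h, IsMarkovKernel (P h)

/-- A Markov policy: for every step, a (measurable) map from states to distributions over
actions. -/
structure Policy (S A : Type*) [MeasurableSpace S] [MeasurableSpace A] where
  /-- action distribution at each step and state -/
  kernel : ℕ → Kernel S A
  markov : ∀ h, IsMarkovKernel (kernel h)

section Game

variable {S A B : Type*} [MeasurableSpace S] [MeasurableSpace A] [MeasurableSpace B]

instance (G : MarkovGame S A B) (h : ℕ) : IsMarkovKernel (G.P h) := G.markov h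

instance (π : Policy S A) (h : ℕ) : IsMarkovKernel (π.kernel h) := π.markov h

/-- Law of `(s_h, a_h, b_h)` given `s_h`, where `a_h ∼ π_h(· ∣ s_h)` and `b_h ∼ ν_h(· ∣ s_h)` are
drawn independently. -/
def actLaw (π : Policy S A) (ν : Policy S B) (h : ℕ) : Kernel S (S × A × B) :=
  Kernel.id ×ₖ (π.kernel h ×ₖ ν.kernel h)

/-- Law of `s_{h+n}` given `s_h`, when the players follow `(π, ν)`. -/
def stateLaw (G : MarkovGame S A B) (π : Policy S A) (ν : Policy S B) (h : ℕ) :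
    ℕ → Kernel S S
  | 0 => Kernel.id
  | n + 1 => (G.P (h + n) ∘ₖ actLaw π ν (h + n)) ∘ₖ stateLaw G π ν h n

/-- `E_{π,ν}[f(s_k, a_k, b_k) ∣ s_h = s]`, for `h ≤ k`. -/
def expect (G : MarkovGame S A B) (π : Policy S A) (ν : Policy S B) (h k : ℕ)
    (f : S × A × B → ℝ) (s : S) : ℝ :=
  ∫ z, f z ∂((actLaw π ν k ∘ₖ stateLaw G π ν h (k - h)) s)

/-- Value function `V_h^{π,ν}(s) = E_{π,ν}[∑_{k=h}^H r_k(s_k, a_k, b_k) ∣ s_h = s]`. -/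
def value (G : MarkovGame S A B) (π : Policy S A) (ν : Policy S B) (h : ℕ) (s : S) : ℝ :=
  ∑ k ∈ Finset.Icc h G.H, expect G π ν h k (G.reward k) s

/-- Nash equilibrium: the two policies are best responses to each other, at every step and
state. -/
def IsNash (G : MarkovGame S A B) (π : Policy S A) (ν : Policy S B) : Prop :=
  ∀ h ∈ Finset.Icc 1 G.H, ∀ s : S,
    (∀ π₁ : Policy S A, value G π₁ ν h s ≤ value G π ν h s) ∧
    (∀ ν₁ : Policy S B, value G π ν h s ≤ value G π ν₁ h s)

/-- Duality gap `V_1^{*,ν}(x) - V_1^{π,*}(x)`. -/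
def dualityGap (G : MarkovGame S A B) (π : Policy S A) (ν : Policy S B) (x : S) : ℝ :=
  (⨆ π₁ : Policy S A, value G π₁ ν 1 x) - (⨅ ν₁ : Policy S B, value G π ν₁ 1 x)

/-- Linear Markov game with feature map `φ`. The size of the vector `μ` of signed measures is
measured by the Euclidean norm of the vector of the total masses `|μ i|(S)`. -/
structure IsLinear (G : MarkovGame S A B) {d : ℕ} (φ : S × A × B → Fin d → ℝ) : Prop where
  measurable_feature : Measurable φ
  norm_feature_le : ∀ z, ‖WithLp.toLp 2 (φ z)‖ ≤ 1
  reward_linear : ∀ h ∈ Finset.Icc 1 G.H, ∃ θ : Fin d → ℝ,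
    ‖WithLp.toLp 2 θ‖ ≤ √d ∧ ∀ z, G.reward h z = φ z ⬝ᵥ θ
  transition_linear : ∀ h ∈ Finset.Icc 1 G.H, ∃ μ : Fin d → SignedMeasure S,
    ‖WithLp.toLp 2 (fun i => (μ i).totalVariation.real Set.univ)‖ ≤ √d ∧
    ∀ z, ∀ T : Set S, MeasurableSet T → (G.P h z).real T = ∑ i, φ z i * μ i T

/-- Joint law of `(r_h, s_{h+1})` given `(s_h, a_h, b_h) = z`. -/
def outcomeLaw (G : MarkovGame S A B) (h : ℕ) (z : S × A × B) : Measure (ℝ × S) :=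
  (Measure.dirac (G.reward h z)).prod (G.P h z)

end Game

/-- A realized dataset of `K` trajectories. -/
structure Dataset (K : ℕ) (S A B : Type*) where
  /-- `state h τ` is `s_h^τ`, for `h = 1, …, H + 1` -/
  state : ℕ → Fin K → S
  /-- `act₁ h τ` is `a_h^τ` -/
  act₁ : ℕ → Fin K → A
  /-- `act₂ h τ` is `b_h^τ` -/
  act₂ : ℕ → Fin K → B
  /-- `rew h τ` is `r_h^τ` -/
  rew : ℕ → Fin K → ℝ

/-- The triple `(s_h^τ, a_h^τ, b_h^τ)`. -/
def Dataset.input {K : ℕ} {S A B : Type*} (D : Dataset K S A B) (h : ℕ) (τ : Fin K) :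
    S × A × B :=
  (D.state h τ, D.act₁ h τ, D.act₂ h τ)

/-- The pair `(r_h^τ, s_{h+1}^τ)`. -/
def Dataset.outcome {K : ℕ} {S A B : Type*} (D : Dataset K S A B) (h : ℕ) (τ : Fin K) :
    ℝ × S :=
  (D.rew h τ, D.state (h + 1) τ)

section Compliance

variable {S A B Ω : Type*} [MeasurableSpace S] [MeasurableSpace A] [MeasurableSpace B]

/-- The σ-algebra generated by `(s_h^i, a_h^i, b_h^i)`, `i ≤ τ`, and `(r_h^i, s_{h+1}^i)`,
`i < τ`. -/
abbrev pastInfo {K : ℕ} (D : Ω → Dataset K S A B) (h : ℕ) (τ : Fin K) : MeasurableSpace Ω :=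
  (⨆ i : Fin K, ⨆ _ : i ≤ τ,
      MeasurableSpace.comap (fun ω => (D ω).input h i) inferInstance) ⊔
    (⨆ i : Fin K, ⨆ _ : i < τ,
      MeasurableSpace.comap (fun ω => (D ω).outcome h i) inferInstance)

/-- The random dataset `D` is compliant with the game `G`: conditionally on `pastInfo D h τ`, the
pair `(r_h^τ, s_{h+1}^τ)` is generated by `G` from `(s_h^τ, a_h^τ, b_h^τ)`. -/
structure IsCompliant [MeasurableSpace Ω] (Pr : Measure Ω) (G : MarkovGame S A B) {K : ℕ}
    (D : Ω → Dataset K S A B) : Prop where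
  measurable_input : ∀ h ∈ Finset.Icc 1 G.H, ∀ τ, Measurable fun ω => (D ω).input h τ
  measurable_outcome : ∀ h ∈ Finset.Icc 1 G.H, ∀ τ, Measurable fun ω => (D ω).outcome h τ
  cond_law : ∀ h ∈ Finset.Icc 1 G.H, ∀ τ, ∀ E : Set (ℝ × S), MeasurableSet E →
    Pr[Set.indicator {ω | (D ω).outcome h τ ∈ E} (fun _ => (1 : ℝ)) | pastInfo D h τ]
      =ᵐ[Pr] fun ω => (outcomeLaw G h ((D ω).input h τ)).real E

end Compliance

section Regression

variable {S A B : Type*} {K d : ℕ}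

/-- `Λ_h = ∑_τ φ_h^τ (φ_h^τ)ᵀ + I`. -/
def gram (φ : S × A × B → Fin d → ℝ) (D : Dataset K S A B) (h : ℕ) :
    Matrix (Fin d) (Fin d) ℝ :=
  ∑ τ, Matrix.vecMulVec (φ (D.input h τ)) (φ (D.input h τ)) + 1

/-- `‖φ(z)‖_{Λ_h⁻¹} = √(φ(z)ᵀ Λ_h⁻¹ φ(z))`. -/
def uncertainty (φ : S × A × B → Fin d → ℝ) (D : Dataset K S A B) (h : ℕ) (z : S × A × B) : ℝ :=
  √(φ z ⬝ᵥ ((gram φ D h)⁻¹ *ᵥ φ z))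

/-- `Λ_h⁻¹ ∑_τ φ_h^τ (r_h^τ + V(s_{h+1}^τ))`. -/
def ridge (φ : S × A × B → Fin d → ℝ) (D : Dataset K S A B) (h : ℕ) (V : S → ℝ) : Fin d → ℝ :=
  (gram φ D h)⁻¹ *ᵥ ∑ τ, (D.rew h τ + V (D.state (h + 1) τ)) • φ (D.input h τ)

/-- Truncation `Π_m(y) = min{m, max{y, 0}}`. -/
def clip (m y : ℝ) : ℝ := min m (max y 0)

/-- Estimated Q-function at step `h`, built from the next estimated value function `V` with
bonus `κ ‖φ‖_{Λ_h⁻¹}`. The pessimistic estimate for the max-player has `κ = -β`, the one for the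
min-player has `κ = β`. -/
def estQ (H : ℕ) (φ : S × A × B → Fin d → ℝ) (D : Dataset K S A B) (κ : ℝ) (h : ℕ)
    (V : S → ℝ) (z : S × A × B) : ℝ :=
  clip ((H : ℝ) - h + 1) (φ z ⬝ᵥ ridge φ D h V + κ * uncertainty φ D h z)

end Regression

section Algorithm

variable {S A B : Type*} [MeasurableSpace S] [MeasurableSpace A] [MeasurableSpace B] {K d : ℕ}

/-- Expected payoff of the matrix game `M` under mixed strategies `p` and `q`. -/
def payoff (M : A → B → ℝ) (p : Measure A) (q : Measure B) : ℝ := ∫ a, ∫ b, M a b ∂q ∂p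

/-- `(p, q)` is a Nash equilibrium of the zero-sum matrix game `M` (rows maximize). -/
def IsMatrixNash (M : A → B → ℝ) (p : Measure A) (q : Measure B) : Prop :=
  (∀ p₁ : Measure A, IsProbabilityMeasure p₁ → payoff M p₁ q ≤ payoff M p q) ∧
  (∀ q₁ : Measure B, IsProbabilityMeasure q₁ → payoff M p q ≤ payoff M p q₁)

/-- Backward recursion for the estimated value functions, when the matrix games of all steps are
played according to `(π, ν)`: `estV … n` is the estimate at step `H + 1 - n`. It is `0` at step
`H + 1`, and at step `H - n` it is the expected estimated Q-function. -/
def estV (H : ℕ) (φ : S × A × B → Fin d → ℝ) (D : Dataset K S A B) (κ : ℝ)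
    (π : Policy S A) (ν : Policy S B) : ℕ → S → ℝ
  | 0 => fun _ => 0
  | n + 1 => fun s =>
      payoff (fun a b => estQ H φ D κ (H - n) (estV H φ D κ π ν n) (s, a, b))
        (π.kernel (H - n) s) (ν.kernel (H - n) s)

/-- The policies `(π̂, ν')` and `(π', ν̂)` arise in a run of pessimistic minimax value iteration
with parameter `β` on the dataset `D`: at every step and state they are Nash equilibria of the
matrix games given by the lower and by the upper estimated Q-function. The output of the run is
`(π̂, ν̂)`. -/
structure IsPMVIRun (H : ℕ) (φ : S × A × B → Fin d → ℝ) (D : Dataset K S A B) (β : ℝ)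
    (πhat : Policy S A) (ν' : Policy S B) (π' : Policy S A) (νhat : Policy S B) : Prop where
  lower : ∀ h ∈ Finset.Icc 1 H, ∀ s : S,
    IsMatrixNash
      (fun a b => estQ H φ D (-β) h (estV H φ D (-β) πhat ν' (H - h)) (s, a, b))
      (πhat.kernel h s) (ν'.kernel h s)
  upper : ∀ h ∈ Finset.Icc 1 H, ∀ s : S,
    IsMatrixNash
      (fun a b => estQ H φ D β h (estV H φ D β π' νhat (H - h)) (s, a, b))
      (π'.kernel h s) (νhat.kernel h s)

/-- `∑_{h=1}^H E_{π,ν}[‖φ_h‖_{Λ_h⁻¹} ∣ s_1 = x]`, for a fixed dataset. -/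
def totalUncertainty (G : MarkovGame S A B) (φ : S × A × B → Fin d → ℝ) (D : Dataset K S A B)
    (π : Policy S A) (ν : Policy S B) (x : S) : ℝ :=
  ∑ h ∈ Finset.Icc 1 G.H, expect G π ν 1 h (uncertainty φ D h) x

/-- Relative uncertainty of the pair `(π, ν)`. -/
def relUncertaintyOf (G : MarkovGame S A B) (φ : S × A × B → Fin d → ℝ) (D : Dataset K S A B)
    (π : Policy S A) (ν : Policy S B) (x : S) : ℝ :=
  max (⨆ ν₁ : Policy S B, totalUncertainty G φ D π ν₁ x)
    (⨆ π₁ : Policy S A, totalUncertainty G φ D π₁ ν x)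

/-- Relative uncertainty of the dataset: the infimum over all Nash equilibria. -/
def relUncertainty (G : MarkovGame S A B) (φ : S × A × B → Fin d → ℝ) (D : Dataset K S A B)
    (x : S) : EReal :=
  ⨅ (p : Policy S A × Policy S B) (_ : IsNash G p.1 p.2),
    ((relUncertaintyOf G φ D p.1 p.2 x : ℝ) : EReal)

end Algorithm

end ZeroSumMG

end

/-! The algorithm computes two value functions by backward recursion, a lower one V̲ and an upper
one V̄. Everything rests on one event: at every step and every (s, a, b), the ridge estimate of the
Bellman backup of the estimated next value is off by at most the bonus β‖φ‖_{Λ_h⁻¹}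
(`BonusDominates`).

Given this event, the rest is deterministic. Backups lie in the clipping range, so the lower
Q-estimate is below the backup and the upper one above it, each by at most two bonuses. In an
equilibrium of a matrix game either player may be switched to an arbitrary strategy with a known
sign of the change in payoff. Comparison with the Bellman equation then gives four inequalities: V̲
≤ V^{π̂,ν} for all ν, V^{π,ν̂} ≤ V̄ for all π, V^{π*,ν'} - V̲ ≤ 2β U(π*,ν') and V̄ - V^{π',ν*} ≤ 2β
U(π',ν*). The first two bound the duality gap by V̄ - V̲. The last two, with V^{π',ν*} ≤ V^{π*,ν'}
from the saddle point property, bound V̄ - V̲ (`dualityGap_le`). Both terms U are at most the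
relative uncertainty of (π*,ν'*) for ν'* = ν*, whence the factor 4β.

The difficulty in the event is that the estimated next value depends on the data it is regressed on.
All equilibria of a matrix game have the same payoff, so whatever equilibria are chosen, the
estimate lies in a class `quadValue` indexed by a bounded vector and a bounded matrix. A finite grid
of parameters is a net of this class. Its members are deterministic functions, for which the noise
satisfies a self-normalized bound: exp(‖S‖²_{Λ⁻¹}/2)/√(det Λ) has mean at most 1
(`lintegral_selfNormalizedExp_le`). A union bound over the grid
(`IsCompliant.exists_accurate_event`), the discretization error and the ridge bias together give the
regression error (`IsLinear.abs_ridge_sub_backup_le`). The class depends on β, but the logarithm of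
the net size is at most linear in c, whereas β² is quadratic in c. Hence all large c work
(`error_le_bonus`). -/

namespace ZeroSumMG

/-! ### Seminorms of positive semidefinite matrices -/

section QuadraticForm

variable {d : ℕ} {M : Matrix (Fin d) (Fin d) ℝ}

theorem dotProduct_mulVec_symm (hM : M.IsHermitian) (u v : Fin d → ℝ) :
    u ⬝ᵥ (M *ᵥ v) = v ⬝ᵥ (M *ᵥ u) := by
  have h : Mᵀ = M := by simpa [Matrix.IsHermitian] using hM
  rw [Matrix.dotProduct_mulVec, ← Matrix.mulVec_transpose, h, dotProduct_comm]

theorem quadForm_nonneg (hM : M.PosSemidef) (u : Fin d → ℝ) : 0 ≤ u ⬝ᵥ (M *ᵥ u) := by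
  simpa using hM.dotProduct_mulVec_nonneg u

theorem quadForm_add (hM : M.IsHermitian) (u v : Fin d → ℝ) (t : ℝ) :
    (u + t • v) ⬝ᵥ (M *ᵥ (u + t • v)) =
      u ⬝ᵥ (M *ᵥ u) + 2 * t * (v ⬝ᵥ (M *ᵥ u)) + t ^ 2 * (v ⬝ᵥ (M *ᵥ v)) := by
  have := dotProduct_mulVec_symm hM u v
  simp only [Matrix.mulVec_add, Matrix.mulVec_smul, add_dotProduct, dotProduct_add,
    smul_dotProduct, dotProduct_smul, smul_eq_mul, this]
  ring

/-- The quadratic polynomial t ↦ ‖v + t u‖²_M is nonnegative, so its discriminant is not positive.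
Definiteness of M plays no role. -/
theorem dotProduct_mulVec_sq_le (hM : M.PosSemidef) (u v : Fin d → ℝ) :
    (u ⬝ᵥ (M *ᵥ v)) ^ 2 ≤ (u ⬝ᵥ (M *ᵥ u)) * (v ⬝ᵥ (M *ᵥ v)) := by
  have h : ∀ t : ℝ, 0 ≤ (u ⬝ᵥ (M *ᵥ u)) * (t * t) + (2 * (u ⬝ᵥ (M *ᵥ v))) * t +
      v ⬝ᵥ (M *ᵥ v) := by
    intro t
    have := quadForm_nonneg hM (v + t • u)
    rw [quadForm_add hM.1] at this
    linarith
  have := discrim_le_zero h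
  unfold discrim at this
  linarith

theorem abs_dotProduct_mulVec_le (hM : M.PosSemidef) (u v : Fin d → ℝ) :
    |u ⬝ᵥ (M *ᵥ v)| ≤ √(u ⬝ᵥ (M *ᵥ u)) * √(v ⬝ᵥ (M *ᵥ v)) := by
  rw [← Real.sqrt_mul (quadForm_nonneg hM u)]
  exact Real.abs_le_sqrt (dotProduct_mulVec_sq_le hM u v)

theorem sqrt_quadForm_add_le (hM : M.PosSemidef) (u v : Fin d → ℝ) :
    √((u + v) ⬝ᵥ (M *ᵥ (u + v))) ≤ √(u ⬝ᵥ (M *ᵥ u)) + √(v ⬝ᵥ (M *ᵥ v)) := by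
  rw [Real.sqrt_le_left (by positivity)]
  have h := quadForm_add hM.1 u v 1
  rw [one_smul] at h
  have h2 := (le_abs_self _).trans (abs_dotProduct_mulVec_le hM v u)
  have h3 := Real.sq_sqrt (quadForm_nonneg hM u)
  have h4 := Real.sq_sqrt (quadForm_nonneg hM v)
  nlinarith

theorem dotProduct_self_nonneg' (u : Fin d → ℝ) : 0 ≤ u ⬝ᵥ u := by
  simpa using quadForm_nonneg (M := (1 : Matrix (Fin d) (Fin d) ℝ)) Matrix.PosSemidef.one u

theorem sqrt_dotProduct_self (u : Fin d → ℝ) : √(u ⬝ᵥ u) = ‖WithLp.toLp 2 u‖ := by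
  rw [EuclideanSpace.norm_eq]
  simp [dotProduct, sq]

end QuadraticForm

/-! ### Regularized Gram matrices and their rank-one updates -/

section RegularizedGram

/-- The matrix `∑_{i ∈ s} v_i v_iᵀ + 1`. -/
def regGram {ι : Type*} {d : ℕ} (s : Finset ι) (v : ι → Fin d → ℝ) : Matrix (Fin d) (Fin d) ℝ :=
  ∑ i ∈ s, Matrix.vecMulVec (v i) (v i) + 1

variable {ι : Type*} {d : ℕ} (s : Finset ι) (v : ι → Fin d → ℝ)

theorem posSemidef_sum_vecMulVec : (∑ i ∈ s, Matrix.vecMulVec (v i) (v i)).PosSemidef :=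
  Matrix.posSemidef_sum _ fun i _ => by simpa using Matrix.posSemidef_vecMulVec_self_star (v i)

theorem regGram_posDef : (regGram s v).PosDef :=
  Matrix.PosDef.posSemidef_add (posSemidef_sum_vecMulVec s v) Matrix.PosDef.one

theorem regGram_inv_posSemidef : (regGram s v)⁻¹.PosSemidef := (regGram_posDef s v).inv.posSemidef

theorem regGram_isUnit_det : IsUnit (regGram s v).det :=
  isUnit_iff_ne_zero.2 (regGram_posDef s v).det_pos.ne'

theorem regGram_mulVec_inv (u : Fin d → ℝ) : regGram s v *ᵥ ((regGram s v)⁻¹ *ᵥ u) = u := by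
  rw [Matrix.mulVec_mulVec, Matrix.mul_nonsing_inv _ (regGram_isUnit_det s v), Matrix.one_mulVec]

theorem regGram_inv_mulVec (u : Fin d → ℝ) : (regGram s v)⁻¹ *ᵥ (regGram s v *ᵥ u) = u := by
  rw [Matrix.mulVec_mulVec, Matrix.nonsing_inv_mul _ (regGram_isUnit_det s v), Matrix.one_mulVec]

theorem regGram_mulVec (u : Fin d → ℝ) :
    regGram s v *ᵥ u = ∑ i ∈ s, (v i ⬝ᵥ u) • v i + u := by
  rw [regGram, Matrix.add_mulVec, Matrix.one_mulVec, Matrix.sum_mulVec]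
  congr 1
  refine Finset.sum_congr rfl fun i _ => ?_
  rw [Matrix.vecMulVec_mulVec]
  simp

/-- `‖u‖_{Λ⁻¹} ≤ ‖u‖` and `‖Λ⁻¹ u‖ ≤ ‖u‖`, squared. -/
theorem regGram_inv_bounds (u : Fin d → ℝ) :
    u ⬝ᵥ ((regGram s v)⁻¹ *ᵥ u) ≤ u ⬝ᵥ u ∧
    ((regGram s v)⁻¹ *ᵥ u) ⬝ᵥ ((regGram s v)⁻¹ *ᵥ u) ≤ u ⬝ᵥ u := by
  set y := (regGram s v)⁻¹ *ᵥ u with hy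
  -- With Λ the regularized matrix, u = Λy = z + y and y ⬝ z ≥ 0. Both bounds follow by dropping
  -- nonnegative terms from the expansion of ‖z + y‖².
  set z := (∑ i ∈ s, Matrix.vecMulVec (v i) (v i)) *ᵥ y with hz
  have hu : u = z + y := by
    have := regGram_mulVec_inv s v u
    rw [← hy, regGram, Matrix.add_mulVec, Matrix.one_mulVec] at this
    exact this.symm
  have h1 : 0 ≤ y ⬝ᵥ z := quadForm_nonneg (posSemidef_sum_vecMulVec s v) y
  have h2 := dotProduct_self_nonneg' z
  have h3 := dotProduct_comm y z
  constructor
  · simp only [hu, add_dotProduct, dotProduct_add]; linarith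
  · simp only [hu, add_dotProduct, dotProduct_add]; linarith

theorem sqrt_regGram_inv_le (u : Fin d → ℝ) :
    √(u ⬝ᵥ ((regGram s v)⁻¹ *ᵥ u)) ≤ ‖WithLp.toLp 2 u‖ := by
  rw [← sqrt_dotProduct_self]
  exact Real.sqrt_le_sqrt (regGram_inv_bounds s v u).1

theorem norm_regGram_inv_mulVec_le (u : Fin d → ℝ) :
    ‖WithLp.toLp 2 ((regGram s v)⁻¹ *ᵥ u)‖ ≤ ‖WithLp.toLp 2 u‖ := by
  rw [← sqrt_dotProduct_self, ← sqrt_dotProduct_self]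
  exact Real.sqrt_le_sqrt (regGram_inv_bounds s v u).2

theorem abs_apply_le_norm (u : Fin d → ℝ) (i : Fin d) : |u i| ≤ ‖WithLp.toLp 2 u‖ := by
  simpa using PiLp.norm_apply_le (WithLp.toLp 2 u) i

theorem abs_regGram_inv_apply_le (i j : Fin d) : |(regGram s v)⁻¹ i j| ≤ 1 := by
  have h := (abs_apply_le_norm _ i).trans (norm_regGram_inv_mulVec_le s v (Pi.single j 1))
  simpa using h

theorem regGram_insert [DecidableEq ι] {i : ι} (hi : i ∉ s) :
    regGram (insert i s) v = regGram s v + Matrix.vecMulVec (v i) (v i) := by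
  rw [regGram, regGram, Finset.sum_insert hi]; abel

theorem det_regGram_insert [DecidableEq ι] {i : ι} (hi : i ∉ s) :
    (regGram (insert i s) v).det =
      (regGram s v).det * (1 + v i ⬝ᵥ ((regGram s v)⁻¹ *ᵥ v i)) := by
  rw [regGram_insert s v hi, Matrix.vecMulVec_eq Unit,
    Matrix.det_add_replicateCol_mul_replicateRow (regGram_isUnit_det s v)]
  congr 1
  rw [Matrix.det_unique]
  simp only [Matrix.add_apply, Matrix.one_apply_eq]
  congr 1
  rw [Matrix.mul_assoc, Matrix.mul_apply_eq_vecMul, Matrix.vecMul_eq_sum]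
  simp [dotProduct, Matrix.mul_apply, Matrix.mulVec]

/-- Sherman–Morrison update of the squared norm of a weighted sum. -/
theorem regGram_insert_quadForm [DecidableEq ι] {i : ι} (hi : i ∉ s) (S : Fin d → ℝ) (e : ℝ) :
    (S + e • v i) ⬝ᵥ ((regGram (insert i s) v)⁻¹ *ᵥ (S + e • v i)) =
      S ⬝ᵥ ((regGram s v)⁻¹ *ᵥ S) +
        (2 * e * (v i ⬝ᵥ ((regGram s v)⁻¹ *ᵥ S)) + e ^ 2 * (v i ⬝ᵥ ((regGram s v)⁻¹ *ᵥ v i))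
          - (v i ⬝ᵥ ((regGram s v)⁻¹ *ᵥ S)) ^ 2) / (1 + v i ⬝ᵥ ((regGram s v)⁻¹ *ᵥ v i)) := by
  have hH := (regGram_inv_posSemidef s v).1
  have hw : 0 ≤ v i ⬝ᵥ ((regGram s v)⁻¹ *ᵥ v i) := quadForm_nonneg (regGram_inv_posSemidef s v) _
  set T := S + e • v i with hT
  set W := (regGram s v)⁻¹ with hW
  set y := (regGram (insert i s) v)⁻¹ *ᵥ T with hy
  -- Instead of a formula for the updated inverse, y is characterized by its linear equation.
  -- Pairing the equation with v i gives a scalar equation for v i ⬝ y, solved in `h8`.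
  have h1 : regGram s v *ᵥ y + (v i ⬝ᵥ y) • v i = T := by
    have := regGram_mulVec_inv (insert i s) v T
    rw [← hy, regGram_insert s v hi, Matrix.add_mulVec, Matrix.vecMulVec_mulVec] at this
    simpa using this
  have h2 : y = W *ᵥ T - (v i ⬝ᵥ y) • (W *ᵥ v i) := by
    rw [← h1, Matrix.mulVec_add, regGram_inv_mulVec, Matrix.mulVec_smul]
    simp
  have h3 : v i ⬝ᵥ y = v i ⬝ᵥ (W *ᵥ T) - (v i ⬝ᵥ y) * (v i ⬝ᵥ (W *ᵥ v i)) := by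
    conv_lhs => rw [h2]
    simp [dotProduct_sub]
  have h4 : T ⬝ᵥ y = T ⬝ᵥ (W *ᵥ T) - (v i ⬝ᵥ y) * (T ⬝ᵥ (W *ᵥ v i)) := by
    conv_lhs => rw [h2]
    simp [dotProduct_sub]
  have h5 : v i ⬝ᵥ (W *ᵥ T) = v i ⬝ᵥ (W *ᵥ S) + e * (v i ⬝ᵥ (W *ᵥ v i)) := by
    rw [hT, Matrix.mulVec_add, Matrix.mulVec_smul]; simp [dotProduct_add]
  have h6 : T ⬝ᵥ (W *ᵥ v i) = v i ⬝ᵥ (W *ᵥ T) := dotProduct_mulVec_symm hH _ _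
  have h7 := quadForm_add hH S (v i) e
  rw [← hT] at h7
  rw [h4, h6, h5, h7]
  set w := v i ⬝ᵥ (W *ᵥ v i)
  set x := v i ⬝ᵥ (W *ᵥ S)
  have h8 : v i ⬝ᵥ y = (x + e * w) / (1 + w) := by
    rw [eq_div_iff (by positivity)]; rw [h5] at h3; linarith
  rw [h8]
  field_simp
  ring

/-- Every eigenvalue is at most the trace, which is at most d + |s|. This is cruder than the
arithmetic-geometric mean inequality, but only its logarithm matters. -/
theorem det_regGram_le (hv : ∀ i, ‖WithLp.toLp 2 (v i)‖ ≤ 1) :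
    (regGram s v).det ≤ ((d : ℝ) + s.card) ^ d := by
  have hP := (regGram_posDef s v).posSemidef
  have htr : (regGram s v).trace ≤ (d : ℝ) + s.card := by
    rw [regGram, Matrix.trace_add, Matrix.trace_sum, Matrix.trace_one, Fintype.card_fin, add_comm]
    gcongr
    calc ∑ i ∈ s, (Matrix.vecMulVec (v i) (v i)).trace ≤ ∑ i ∈ s, (1 : ℝ) := by
          refine Finset.sum_le_sum fun i _ => ?_
          rw [Matrix.trace_vecMulVec]
          have := hv i
          rw [← sqrt_dotProduct_self] at this
          simpa using this
      _ = s.card := by simp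
  rw [hP.1.det_eq_prod_eigenvalues]
  have hle : ∀ i, hP.1.eigenvalues i ≤ (d : ℝ) + s.card := by
    intro i
    refine le_trans ?_ htr
    rw [hP.1.trace_eq_sum_eigenvalues]
    exact Finset.single_le_sum (f := fun i => hP.1.eigenvalues i)
      (fun j _ => hP.eigenvalues_nonneg j) (Finset.mem_univ i)
  calc ∏ i, ((hP.1.eigenvalues i : ℝ)) ≤ ∏ _i : Fin d, ((d : ℝ) + s.card) :=
        Finset.prod_le_prod (fun i _ => hP.eigenvalues_nonneg i) fun i _ => hle i
    _ = _ := by simp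

end RegularizedGram

/-! ### Measurability of determinants, inverses and quadratic forms -/

section Measurability

variable {ι Ω : Type*} [MeasurableSpace Ω] {d : ℕ}

theorem measurable_dotProduct {f g : Ω → Fin d → ℝ} (hf : Measurable f) (hg : Measurable g) :
    Measurable fun ω => f ω ⬝ᵥ g ω := by
  unfold dotProduct
  fun_prop

theorem measurable_regGram_apply (s : Finset ι) {v : Ω → ι → Fin d → ℝ}
    (hv : ∀ i ∈ s, Measurable fun ω => v ω i) (a b : Fin d) :
    Measurable fun ω => regGram s (v ω) a b := by
  simp only [regGram, Matrix.add_apply, Matrix.sum_apply, Matrix.vecMulVec_apply]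
  refine Measurable.add (Finset.measurable_sum _ fun i hi => ?_) measurable_const
  have := hv i hi
  fun_prop

theorem measurable_det {M : Ω → Matrix (Fin d) (Fin d) ℝ}
    (hM : ∀ a b, Measurable fun ω => M ω a b) : Measurable fun ω => (M ω).det := by
  simp only [Matrix.det_apply]
  exact Finset.measurable_sum _ fun σ _ =>
    (Finset.measurable_prod _ fun i _ => hM _ _).const_smul _

/-- By Cramer's rule the entries of the inverse are quotients of determinants; a zero determinant
gives the value 0 and needs no separate case. -/
theorem measurable_inv_apply {M : Ω → Matrix (Fin d) (Fin d) ℝ}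
    (hM : ∀ a b, Measurable fun ω => M ω a b) (a b : Fin d) :
    Measurable fun ω => (M ω)⁻¹ a b := by
  simp only [Matrix.inv_def, Ring.inverse_eq_inv', Matrix.smul_apply, smul_eq_mul,
    Matrix.adjugate_apply]
  refine (measurable_det hM).inv.mul (measurable_det fun a' b' => ?_)
  simp only [Matrix.updateRow_apply]
  split_ifs
  · exact measurable_const
  · exact hM _ _

theorem measurable_regGram_inv_form (s : Finset ι) {v : Ω → ι → Fin d → ℝ}
    (hv : ∀ i ∈ s, Measurable fun ω => v ω i) {f g : Ω → Fin d → ℝ}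
    (hf : Measurable f) (hg : Measurable g) :
    Measurable fun ω => f ω ⬝ᵥ ((regGram s (v ω))⁻¹ *ᵥ g ω) := by
  refine measurable_dotProduct hf (measurable_pi_iff.2 fun a => ?_)
  refine measurable_dotProduct (measurable_pi_iff.2 fun b => ?_) hg
  exact measurable_inv_apply (measurable_regGram_apply s hv) a b

end Measurability

/-! ### Integration against a conditional law -/

section ConditionalLaw

variable {Ω Z O X : Type*} {m : MeasurableSpace Ω} [mΩ : MeasurableSpace Ω] [MeasurableSpace Z]
  [MeasurableSpace O] [MeasurableSpace X]

/-- If `κ (z ω)` is the conditional law of `o` given `m`, then averages of functions of `o` and of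
an `m`-measurable variable can be computed by first averaging over `κ (z ω)`. -/
theorem lintegral_eq_of_condLaw {Pr : Measure Ω} [IsProbabilityMeasure Pr]
    (hm : m ≤ mΩ) {x : Ω → X} (hx : Measurable[m] x) {z : Ω → Z} (hz : Measurable[m] z)
    {o : Ω → O} (ho : Measurable o) (κ : Kernel Z O) [IsMarkovKernel κ]
    (hlaw : ∀ E : Set O, MeasurableSet E →
      Pr[Set.indicator {ω | o ω ∈ E} (fun _ => (1 : ℝ)) | m] =ᵐ[Pr] fun ω => (κ (z ω)).real E)
    {f : X × O → ENNReal} (hf : Measurable f) :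
    ∫⁻ ω, f (x ω, o ω) ∂Pr = ∫⁻ ω, ∫⁻ y, f (x ω, y) ∂(κ (z ω)) ∂Pr := by
  have hx' : Measurable x := hx.mono hm le_rfl
  have hz' : Measurable z := hz.mono hm le_rfl
  set κ' : Kernel Ω O := κ.comap z hz' with hκ'
  -- Two laws on X × O are compared on rectangles s × t. Since x⁻¹(s) belongs to m, the equality
  -- there is the defining property of the conditional expectation.
  have key : Pr.map (fun ω => (x ω, o ω)) = (Pr ⊗ₘ κ').map (fun q => (x q.1, q.2)) := by
    have hmap : Measurable fun q : Ω × O => (x q.1, q.2) := by fun_prop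
    have : IsProbabilityMeasure (Pr.map (fun ω => (x ω, o ω))) :=
      Measure.isProbabilityMeasure_map (by fun_prop)
    refine Measure.ext_prod fun {s t} hs ht => ?_
    rw [Measure.map_apply (by fun_prop) (hs.prod ht), Measure.map_apply hmap (hs.prod ht)]
    have e1 : (fun q : Ω × O => (x q.1, q.2)) ⁻¹' s ×ˢ t = (x ⁻¹' s) ×ˢ t := by ext; simp
    have e2 : (fun ω => (x ω, o ω)) ⁻¹' s ×ˢ t = x ⁻¹' s ∩ {ω | o ω ∈ t} := by ext; simp
    rw [e1, e2, Measure.compProd_apply_prod (hx' hs) ht]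
    have hot : MeasurableSet {ω | o ω ∈ t} := ho ht
    have hxs : MeasurableSet[m] (x ⁻¹' s) := hx hs
    have hreal : Pr.real (x ⁻¹' s ∩ {ω | o ω ∈ t}) = ∫ ω in x ⁻¹' s, (κ (z ω)).real t ∂Pr := by
      calc Pr.real (x ⁻¹' s ∩ {ω | o ω ∈ t})
          = ∫ ω in x ⁻¹' s, Set.indicator {ω | o ω ∈ t} (fun _ => (1 : ℝ)) ω ∂Pr := by
            rw [integral_indicator hot, setIntegral_const, measureReal_restrict_apply hot,
              Set.inter_comm]
            simp
        _ = ∫ ω in x ⁻¹' s,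
              (Pr[Set.indicator {ω | o ω ∈ t} (fun _ => (1 : ℝ)) | m]) ω ∂Pr :=
            (setIntegral_condExp hm ((integrable_const 1).indicator hot) hxs).symm
        _ = _ := integral_congr_ae (ae_restrict_of_ae (hlaw t ht))
    have hmeas : Measurable fun ω => κ (z ω) t := (κ.measurable_coe ht).comp hz'
    have h2 : ∫ ω in x ⁻¹' s, (κ (z ω)).real t ∂Pr
        = (∫⁻ ω in x ⁻¹' s, κ (z ω) t ∂Pr).toReal := by
      exact integral_toReal hmeas.aemeasurable (ae_of_all _ fun ω => measure_lt_top _ _)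
    rw [h2] at hreal
    refine (ENNReal.toReal_eq_toReal_iff' (measure_ne_top _ _) ?_).1 hreal
    refine ne_top_of_le_ne_top (measure_ne_top (Pr.restrict (x ⁻¹' s)) Set.univ) ?_
    calc ∫⁻ ω in x ⁻¹' s, κ (z ω) t ∂Pr ≤ ∫⁻ ω in x ⁻¹' s, 1 ∂Pr :=
          lintegral_mono fun ω => prob_le_one
      _ = _ := by simp
  calc ∫⁻ ω, f (x ω, o ω) ∂Pr = ∫⁻ q, f q ∂(Pr.map (fun ω => (x ω, o ω))) :=
        (lintegral_map hf (by fun_prop)).symm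
    _ = ∫⁻ q, f (x q.1, q.2) ∂(Pr ⊗ₘ κ') := by
        rw [key, lintegral_map hf (by fun_prop)]
    _ = _ := by
        rw [Measure.lintegral_compProd (f := fun q : Ω × O => f (x q.1, q.2)) (by fun_prop)]
        simp [hκ', Kernel.comap_apply]

end ConditionalLaw

/-! ### Self-normalized concentration -/

section SelfNormalized

variable {O : Type*} [MeasurableSpace O]

/-- This is log(1 + w) ≥ w/(1 + w), exponentiated after halving. It lets the growth of √(det Λ)
absorb the quadratic part of the noise. -/
theorem exp_half_div_one_add_le_sqrt {w : ℝ} (hw : 0 ≤ w) :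
    Real.exp (w / (2 * (1 + w))) ≤ √(1 + w) := by
  have h := Real.one_sub_inv_le_log_of_pos (x := 1 + w) (by positivity)
  rw [Real.sqrt_eq_rpow, Real.rpow_def_of_pos (by positivity)]
  refine Real.exp_le_exp.2 ?_
  have : w / (2 * (1 + w)) = (1 - (1 + w)⁻¹) / 2 := by field_simp; ring
  rw [this]; linarith

/-- One step of the self-normalized supermartingale. -/
theorem lintegral_selfNormalized_step_le {μ : Measure O} [IsProbabilityMeasure μ] {e : O → ℝ}
    (he : Measurable e) (hb : ∀ y, |e y| ≤ 1) (h0 : ∫ y, e y ∂μ = 0) {w x : ℝ} (hw : 0 ≤ w) :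
    ∫⁻ y, ENNReal.ofReal (Real.exp ((2 * e y * x + e y ^ 2 * w - x ^ 2) / (2 * (1 + w)))
      / √(1 + w)) ∂μ ≤ 1 := by
  set t := x / (1 + w) with ht
  have hsg := hasSubgaussianMGF_of_mem_Icc_of_integral_eq_zero (a := -1) (b := 1)
    he.aemeasurable (ae_of_all μ fun y => abs_le.1 (hb y)) h0
  have hmgf := hsg.mgf_le t
  have hc : ((((‖(1 : ℝ) - -1‖₊ / 2) ^ 2 : NNReal)) : ℝ) = 1 := by
    push_cast; norm_num
  rw [hc, one_mul] at hmgf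
  set C := Real.exp ((w - x ^ 2) / (2 * (1 + w))) / √(1 + w) with hC
  -- Since e² ≤ 1, the exponent is bounded by a function affine in e, and Hoeffding's lemma applies
  -- at t = x/(1 + w). Noise with values in [-1, 1] has variance proxy 1.
  have hpt : ∀ y, Real.exp ((2 * e y * x + e y ^ 2 * w - x ^ 2) / (2 * (1 + w))) / √(1 + w)
      ≤ C * Real.exp (t * e y) := by
    intro y
    rw [hC, div_mul_eq_mul_div, ← Real.exp_add]
    gcongr
    have : (w - x ^ 2) / (2 * (1 + w)) + t * e y =
        (2 * e y * x + w - x ^ 2) / (2 * (1 + w)) := by rw [ht]; field_simp; ring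
    rw [this]
    gcongr
    have := (sq_le_one_iff_abs_le_one (e y)).2 (hb y)
    nlinarith
  have hint : Integrable (fun y => C * Real.exp (t * e y)) μ :=
    (hsg.integrable_exp_mul t).const_mul C
  calc _ ≤ ∫⁻ y, ENNReal.ofReal (C * Real.exp (t * e y)) ∂μ :=
        lintegral_mono fun y => ENNReal.ofReal_le_ofReal (hpt y)
    _ = ENNReal.ofReal (C * mgf e μ t) := by
        rw [← ofReal_integral_eq_lintegral_ofReal hint
          (ae_of_all _ fun y => by positivity), integral_const_mul, mgf]
    _ ≤ ENNReal.ofReal 1 := by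
        refine ENNReal.ofReal_le_ofReal ?_
        calc C * mgf e μ t ≤ C * Real.exp (t ^ 2 / 2) := by gcongr
          _ ≤ Real.exp (w / (2 * (1 + w))) / √(1 + w) := by
              rw [hC, div_mul_eq_mul_div, ← Real.exp_add]
              gcongr
              have h1 : t ^ 2 ≤ x ^ 2 / (1 + w) := by
                rw [ht, div_pow]
                exact div_le_div_of_nonneg_left (by positivity) (by positivity) (by nlinarith)
              have h2 : (w - x ^ 2) / (2 * (1 + w)) =
                w / (2 * (1 + w)) - x ^ 2 / (1 + w) / 2 := by field_simp
              linarith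
          _ ≤ 1 := by
              rw [div_le_one (by positivity)]
              exact exp_half_div_one_add_le_sqrt hw
    _ = 1 := by simp

variable {Ω Z : Type*} [mΩ : MeasurableSpace Ω] [MeasurableSpace Z] {K d : ℕ}

/-- Weighted sum of the noise variables over the first rounds. -/
noncomputable def noiseSum {K d : ℕ} (s : Finset (Fin K)) (v : Fin K → Fin d → ℝ) (e : Fin K → ℝ) : Fin d → ℝ :=
  ∑ i ∈ s, e i • v i

/-- `exp(‖S‖²_{Λ⁻¹} / 2) / √(det Λ)`, for the sums over the rounds in `s`. -/
noncomputable def selfNormalizedExp {K d : ℕ} (s : Finset (Fin K)) (v : Fin K → Fin d → ℝ) (e : Fin K → ℝ) : ℝ :=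
  Real.exp ((noiseSum s v e ⬝ᵥ ((regGram s v)⁻¹ *ᵥ noiseSum s v e)) / 2) / √(regGram s v).det

theorem selfNormalizedExp_insert {s : Finset (Fin K)} {i : Fin K} (hi : i ∉ s)
    (v : Fin K → Fin d → ℝ) (e : Fin K → ℝ) :
    selfNormalizedExp (insert i s) v e = selfNormalizedExp s v e *
      (Real.exp ((2 * e i * (v i ⬝ᵥ ((regGram s v)⁻¹ *ᵥ noiseSum s v e)) +
        e i ^ 2 * (v i ⬝ᵥ ((regGram s v)⁻¹ *ᵥ v i)) -
        (v i ⬝ᵥ ((regGram s v)⁻¹ *ᵥ noiseSum s v e)) ^ 2) /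
          (2 * (1 + v i ⬝ᵥ ((regGram s v)⁻¹ *ᵥ v i)))) /
        √(1 + v i ⬝ᵥ ((regGram s v)⁻¹ *ᵥ v i))) := by
  have h1 : noiseSum (insert i s) v e = noiseSum s v e + e i • v i := by
    rw [noiseSum, noiseSum, Finset.sum_insert hi, add_comm]
  unfold selfNormalizedExp
  rw [h1, regGram_insert_quadForm s v hi, det_regGram_insert s v hi,
    Real.sqrt_mul (regGram_posDef s v).det_pos.le, div_mul_div_comm, ← Real.exp_add]
  congr 2
  rw [add_div, div_div, mul_comm _ (2 : ℝ)]

theorem measurable_noiseSum (s : Finset (Fin K)) {v : Ω → Fin K → Fin d → ℝ}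
    {e : Ω → Fin K → ℝ} (hv : ∀ i ∈ s, Measurable fun ω => v ω i)
    (he : ∀ i ∈ s, Measurable fun ω => e ω i) :
    Measurable fun ω => noiseSum s (v ω) (e ω) := by
  unfold noiseSum
  refine Finset.measurable_sum _ fun i hi => (he i hi).smul (hv i hi)

theorem measurable_selfNormalizedExp (s : Finset (Fin K)) {v : Ω → Fin K → Fin d → ℝ}
    {e : Ω → Fin K → ℝ} (hv : ∀ i ∈ s, Measurable fun ω => v ω i)
    (he : ∀ i ∈ s, Measurable fun ω => e ω i) :
    Measurable fun ω => selfNormalizedExp s (v ω) (e ω) := by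
  unfold selfNormalizedExp
  have h := measurable_noiseSum s hv he
  exact ((measurable_regGram_inv_form s hv h h).div_const 2).exp.div
    (measurable_det (measurable_regGram_apply s hv)).sqrt

/-- Supermartingale argument: a new round multiplies `selfNormalizedExp` by a factor whose
conditional mean given the past is at most 1, and the empty product is 1. The filtrations contain
the current input but not the current outcome. -/
theorem lintegral_selfNormalizedExp_le {Pr : Measure Ω} [IsProbabilityMeasure Pr]
    {m : Fin K → MeasurableSpace Ω} (hm : ∀ i, m i ≤ mΩ) {z : Ω → Fin K → Z} {o : Ω → Fin K → O}
    (hz : ∀ i j, i ≤ j → Measurable[m j] fun ω => z ω i)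
    (ho : ∀ i j, i < j → Measurable[m j] fun ω => o ω i) (ho' : ∀ i, Measurable fun ω => o ω i)
    (κ : Kernel Z O) [IsMarkovKernel κ]
    (hlaw : ∀ i, ∀ E : Set O, MeasurableSet E →
      Pr[Set.indicator {ω | o ω i ∈ E} (fun _ => (1 : ℝ)) | m i]
        =ᵐ[Pr] fun ω => (κ (z ω i)).real E)
    {ψ : Z → Fin d → ℝ} (hψ : Measurable ψ) {e : Z × O → ℝ} (he : Measurable e)
    (hb : ∀ q, |e q| ≤ 1) (h0 : ∀ q, ∫ y, e (q, y) ∂(κ q) = 0) :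
    ∫⁻ ω, ENNReal.ofReal (selfNormalizedExp Finset.univ (fun i => ψ (z ω i))
      (fun i => e (z ω i, o ω i))) ∂Pr ≤ 1 := by
  suffices H : ∀ k : ℕ, k ≤ K → ∫⁻ ω, ENNReal.ofReal (selfNormalizedExp
      (Finset.univ.filter fun i : Fin K => (i : ℕ) < k) (fun i => ψ (z ω i))
      (fun i => e (z ω i, o ω i))) ∂Pr ≤ 1 by
    have := H K le_rfl
    rwa [Finset.filter_true_of_mem fun i _ => i.2] at this
  intro k
  induction k with
  | zero => intro _; simp [selfNormalizedExp, noiseSum, regGram]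
  | succ k ih =>
    intro hk
    refine le_trans ?_ (ih (by omega))
    set s := Finset.univ.filter fun i : Fin K => (i : ℕ) < k with hs
    set j : Fin K := ⟨k, by omega⟩ with hj
    have hjs : j ∉ s := by simp [hs, hj]
    have hins : (Finset.univ.filter fun i : Fin K => (i : ℕ) < k + 1) = insert j s := by
      ext i
      simp only [hs, hj, Finset.mem_filter, Finset.mem_univ, true_and, Finset.mem_insert, Fin.ext_iff]
      omega
    have hlt : ∀ i ∈ s, i < j := by
      intro i hi
      simpa [hs, hj, Fin.lt_def] using hi
    rw [hins]
    simp_rw [selfNormalizedExp_insert hjs]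
    set v : Ω → Fin K → Fin d → ℝ := fun ω i => ψ (z ω i) with hv
    set ε : Ω → Fin K → ℝ := fun ω i => e (z ω i, o ω i) with hε
    have hvm : ∀ i ≤ j, Measurable[m j] fun ω => v ω i := fun i hi => hψ.comp (hz i j hi)
    have hεm : ∀ i < j, Measurable[m j] fun ω => ε ω i := fun i hi =>
      he.comp ((hz i j hi.le).prodMk (ho i j hi))
    have hvs : ∀ i ∈ s, Measurable[m j] fun ω => v ω i := fun i hi => hvm i (hlt i hi).le
    have hεs : ∀ i ∈ s, Measurable[m j] fun ω => ε ω i := fun i hi => hεm i (hlt i hi)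
    have hS := measurable_noiseSum (mΩ := m j) s hvs hεs
    have hM := measurable_selfNormalizedExp (mΩ := m j) s hvs hεs
    have hx := @measurable_regGram_inv_form _ _ (m j) _ s _ hvs _ _ (hvm j le_rfl) hS
    have hw := @measurable_regGram_inv_form _ _ (m j) _ s _ hvs _ _ (hvm j le_rfl) (hvm j le_rfl)
    -- The old product, the two scalars x and w of the update and the input of round j form one
    -- variable known before the outcome of round j, so the conditional law can be integrated out
    -- with them frozen.
    have hX := (hM.prodMk (hx.prodMk (hw.prodMk (hz j j le_rfl))))
    have key := lintegral_eq_of_condLaw (hm j) hX (hz j j le_rfl) (ho' j) κ (hlaw j)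
      (f := fun q : (ℝ × ℝ × ℝ × Z) × O => ENNReal.ofReal (q.1.1 *
        (Real.exp ((2 * e (q.1.2.2.2, q.2) * q.1.2.1 + e (q.1.2.2.2, q.2) ^ 2 * q.1.2.2.1
          - q.1.2.1 ^ 2) / (2 * (1 + q.1.2.2.1))) / √(1 + q.1.2.2.1))))
      (by
        have : Measurable fun q : (ℝ × ℝ × ℝ × Z) × O => e (q.1.2.2.2, q.2) := by fun_prop
        fun_prop)
    refine key.le.trans (lintegral_mono fun ω => ?_)
    have hMnn : 0 ≤ selfNormalizedExp s (v ω) (ε ω) := by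
      unfold selfNormalizedExp; positivity
    have hwnn : 0 ≤ v ω j ⬝ᵥ ((regGram s (v ω))⁻¹ *ᵥ v ω j) :=
      quadForm_nonneg (regGram_inv_posSemidef s _) _
    simp_rw [ENNReal.ofReal_mul hMnn]
    rw [lintegral_const_mul _ (by
      have : Measurable fun y => e (z ω j, y) := he.comp measurable_prodMk_left
      fun_prop)]
    refine mul_le_of_le_one_right' ?_
    exact lintegral_selfNormalized_step_le (he.comp measurable_prodMk_left)
      (fun y => hb _) (h0 _) hwnn

/-- Self-normalized concentration for bounded noise. -/
theorem measure_selfNormalized_gt_le {Pr : Measure Ω} [IsProbabilityMeasure Pr]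
    {m : Fin K → MeasurableSpace Ω} (hm : ∀ i, m i ≤ mΩ) {z : Ω → Fin K → Z} {o : Ω → Fin K → O}
    (hz : ∀ i j, i ≤ j → Measurable[m j] fun ω => z ω i)
    (ho : ∀ i j, i < j → Measurable[m j] fun ω => o ω i) (ho' : ∀ i, Measurable fun ω => o ω i)
    (κ : Kernel Z O) [IsMarkovKernel κ]
    (hlaw : ∀ i, ∀ E : Set O, MeasurableSet E →
      Pr[Set.indicator {ω | o ω i ∈ E} (fun _ => (1 : ℝ)) | m i]
        =ᵐ[Pr] fun ω => (κ (z ω i)).real E)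
    {ψ : Z → Fin d → ℝ} (hψ : Measurable ψ) (hψ1 : ∀ q, ‖WithLp.toLp 2 (ψ q)‖ ≤ 1)
    {e : Z × O → ℝ} (he : Measurable e)
    (hb : ∀ q, |e q| ≤ 1) (h0 : ∀ q, ∫ y, e (q, y) ∂(κ q) = 0) {r : ℝ} (hdK : 0 < d + K) :
    Pr {ω | 2 * r + d * Real.log (d + K) ≤
      noiseSum Finset.univ (fun i => ψ (z ω i)) (fun i => e (z ω i, o ω i)) ⬝ᵥ
        ((regGram Finset.univ (fun i => ψ (z ω i)))⁻¹ *ᵥ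
          noiseSum Finset.univ (fun i => ψ (z ω i)) (fun i => e (z ω i, o ω i)))}
      ≤ ENNReal.ofReal (Real.exp (-r)) := by
  have hint := lintegral_selfNormalizedExp_le hm hz ho ho' κ hlaw hψ he hb h0
  have hdK' : (0 : ℝ) < d + K := by exact_mod_cast hdK
  have hzm : ∀ i, Measurable fun ω => z ω i := fun i => (hz i i le_rfl).mono (hm i) le_rfl
  have hmeas : Measurable fun ω => ENNReal.ofReal (selfNormalizedExp Finset.univ
      (fun i => ψ (z ω i)) (fun i => e (z ω i, o ω i))) :=
    (measurable_selfNormalizedExp _ (fun i _ => hψ.comp (hzm i))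
      (fun i _ => he.comp ((hzm i).prodMk (ho' i)))).ennreal_ofReal
  -- Markov's inequality at level exp r. The factor √(det Λ) is then replaced by its deterministic
  -- bound, which contributes the term d log(d + K).
  have hmar := mul_meas_ge_le_lintegral (μ := Pr) hmeas (ENNReal.ofReal (Real.exp r))
  have h1 := hmar.trans hint
  rw [Real.exp_neg, ENNReal.ofReal_inv_of_pos (Real.exp_pos r)]
  rw [mul_comm, ← ENNReal.le_div_iff_mul_le (Or.inl (by simp [Real.exp_pos]))
    (Or.inl ENNReal.ofReal_ne_top), one_div] at h1
  refine (measure_mono fun ω hω => ?_).trans h1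
  simp only [Set.mem_ofPred_eq] at hω ⊢
  refine ENNReal.ofReal_le_ofReal ?_
  unfold selfNormalizedExp
  have hdet := det_regGram_le Finset.univ (fun i => ψ (z ω i)) (fun i => hψ1 _)
  have hpos := (regGram_posDef Finset.univ (fun i => ψ (z ω i))).det_pos
  have hsq : √(regGram Finset.univ (fun i => ψ (z ω i))).det ≤
      Real.exp (d * Real.log (d + K) / 2) := by
    refine (Real.sqrt_le_sqrt hdet).trans (le_of_eq ?_)
    rw [Real.sqrt_eq_iff_mul_self_eq (by positivity) (by positivity), ← Real.exp_add]
    simp only [Finset.card_univ, Fintype.card_fin]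
    rw [add_halves, ← Real.log_pow, Real.exp_log (by positivity)]
  rw [le_div_iff₀ (Real.sqrt_pos.2 hpos)]
  calc _ ≤ Real.exp r * Real.exp (d * Real.log (d + K) / 2) := by gcongr
    _ ≤ _ := by
      rw [← Real.exp_add]
      refine Real.exp_le_exp.2 ?_
      linarith

end SelfNormalized

/-! ### Values of matrix games -/

section MatrixGame

variable {A B : Type*} [MeasurableSpace A] [MeasurableSpace B]

theorem payoff_const (c : ℝ) (p : Measure A) [IsProbabilityMeasure p] (q : Measure B)
    [IsProbabilityMeasure q] : payoff (fun _ _ => c) p q = c := by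
  simp [payoff]

/-- The lower value of a matrix game. -/
noncomputable def gameValue (M : A → B → ℝ) : ℝ :=
  ⨆ p : ProbabilityMeasure A, ⨅ q : ProbabilityMeasure B, payoff M p q

instance probabilityMeasure_nonempty [Nonempty B] : Nonempty (ProbabilityMeasure B) :=
  ⟨⟨Measure.dirac (Classical.arbitrary B), inferInstance⟩⟩

theorem gameValue_const [Nonempty A] [Nonempty B] (c : ℝ) : gameValue (fun (_ : A) (_ : B) => c) = c := by
  simp [gameValue, payoff_const]

variable [Fintype A] [MeasurableSingletonClass A] [Fintype B] [MeasurableSingletonClass B]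

theorem payoff_le_payoff_add {M N : A → B → ℝ} {c : ℝ} (h : ∀ a b, M a b ≤ N a b + c)
    (p : Measure A) [IsProbabilityMeasure p] (q : Measure B) [IsProbabilityMeasure q] :
    payoff M p q ≤ payoff N p q + c := by
  have h1 : payoff N p q + c = ∫ a, (∫ b, N a b ∂q + c) ∂p := by
    rw [integral_add .of_finite .of_finite]; simp [payoff]
  rw [h1]
  refine integral_mono .of_finite .of_finite fun a => ?_
  have h2 : ∫ b, N a b ∂q + c = ∫ b, (N a b + c) ∂q := by
    rw [integral_add .of_finite .of_finite]; simp
  simp only [h2]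
  exact integral_mono .of_finite .of_finite fun b => h a b

theorem payoff_mono {M N : A → B → ℝ} (h : ∀ a b, M a b ≤ N a b)
    (p : Measure A) [IsProbabilityMeasure p] (q : Measure B) [IsProbabilityMeasure q] :
    payoff M p q ≤ payoff N p q := by
  simpa using payoff_le_payoff_add (c := 0) (by simpa using h) p q

theorem payoff_add (M N : A → B → ℝ) (p : Measure A) [IsProbabilityMeasure p] (q : Measure B)
    [IsProbabilityMeasure q] :
    payoff (fun a b => M a b + N a b) p q = payoff M p q + payoff N p q := by
  unfold payoff
  rw [← integral_add .of_finite .of_finite]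
  exact integral_congr_ae (ae_of_all _ fun a => integral_add .of_finite .of_finite)

theorem exists_abs_payoff_le (M : A → B → ℝ) :
    ∃ C, ∀ (p : ProbabilityMeasure A) (q : ProbabilityMeasure B), |payoff M p q| ≤ C := by
  refine ⟨∑ a, ∑ b, |M a b|, fun p q => ?_⟩
  have h : ∀ a b, |M a b| ≤ ∑ a, ∑ b, |M a b| := fun a b =>
    (Finset.single_le_sum (f := fun b => |M a b|) (fun _ _ => abs_nonneg _)
      (Finset.mem_univ b)).trans
    (Finset.single_le_sum (f := fun a => ∑ b, |M a b|)
      (fun _ _ => Finset.sum_nonneg fun _ _ => abs_nonneg _) (Finset.mem_univ a))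
  rw [abs_le, ← payoff_const (-_) (p : Measure A) (q : Measure B)]
  refine ⟨payoff_mono (fun a b => (abs_le.1 (h a b)).1) _ _, ?_⟩
  exact (payoff_mono (fun a b => (abs_le.1 (h a b)).2) (p : Measure A) (q : Measure B)).trans_eq
    (payoff_const _ _ _)

theorem bddBelow_payoff (M : A → B → ℝ) (p : ProbabilityMeasure A) :
    BddBelow (Set.range fun q : ProbabilityMeasure B => payoff M p q) := by
  obtain ⟨C, hC⟩ := exists_abs_payoff_le M
  exact ⟨-C, by rintro _ ⟨q, rfl⟩; exact (abs_le.1 (hC p q)).1⟩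

variable [Nonempty B]

theorem bddAbove_iInf_payoff (M : A → B → ℝ) :
    BddAbove (Set.range fun p : ProbabilityMeasure A =>
      ⨅ q : ProbabilityMeasure B, payoff M p q) := by
  obtain ⟨C, hC⟩ := exists_abs_payoff_le M
  refine ⟨C, ?_⟩
  rintro _ ⟨p, rfl⟩
  exact (ciInf_le (bddBelow_payoff M p) (Classical.arbitrary _)).trans (abs_le.1 (hC p _)).2

variable [Nonempty A]

/-- An equilibrium payoff is guaranteed by p and cannot be exceeded against q. No minimax theorem is
needed, as an equilibrium is given. This makes the estimated values independent of the equilibria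
selected by the algorithm. -/
theorem IsMatrixNash.payoff_eq_gameValue {M : A → B → ℝ} {p : Measure A} {q : Measure B}
    [hp : IsProbabilityMeasure p] [hq : IsProbabilityMeasure q] (h : IsMatrixNash M p q) :
    payoff M p q = gameValue M := by
  apply le_antisymm
  · refine le_trans ?_ (le_ciSup (bddAbove_iInf_payoff M) ⟨p, hp⟩)
    exact le_ciInf fun q₁ => h.2 q₁ inferInstance
  · refine ciSup_le fun p₁ => ?_
    exact (ciInf_le (bddBelow_payoff M p₁) ⟨q, hq⟩).trans (h.1 p₁ inferInstance)

/-- The value is monotone and commutes with adding constants, hence is 1-Lipschitz in the sup norm.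
Both its measurability in the state and the covering argument rest on this. -/
theorem gameValue_le_add {M N : A → B → ℝ} {c : ℝ} (h : ∀ a b, M a b ≤ N a b + c) :
    gameValue M ≤ gameValue N + c := by
  refine ciSup_le fun p => ?_
  rw [← sub_le_iff_le_add]
  refine le_trans ?_ (le_ciSup (bddAbove_iInf_payoff N) p)
  refine le_ciInf fun q => ?_
  rw [sub_le_iff_le_add]
  exact (ciInf_le (bddBelow_payoff M p) q).trans (payoff_le_payoff_add h _ _)

theorem gameValue_mem_Icc {M : A → B → ℝ} {m : ℝ} (h : ∀ a b, M a b ∈ Set.Icc 0 m) :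
    gameValue M ∈ Set.Icc 0 m := by
  constructor
  · have := gameValue_le_add (M := fun (_ : A) (_ : B) => (0 : ℝ)) (N := M) (c := 0)
      fun a b => by simpa using (h a b).1
    simpa [gameValue_const] using this
  · have := gameValue_le_add (M := M) (N := fun (_ : A) (_ : B) => m) (c := 0)
      fun a b => by simpa using (h a b).2
    simpa [gameValue_const] using this

theorem continuous_gameValue : Continuous (gameValue : (A → B → ℝ) → ℝ) := by
  refine (LipschitzWith.of_le_add fun M N => gameValue_le_add fun a b => ?_).continuous
  have h1 : |M a b - N a b| ≤ dist M N := by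
    rw [← Real.dist_eq]
    exact (dist_le_pi_dist (M a) (N a) b).trans (dist_le_pi_dist M N a)
  linarith [le_abs_self (M a b - N a b)]

theorem measurable_gameValue {S : Type*} [MeasurableSpace S] {M : S → A → B → ℝ}
    (hM : ∀ a b, Measurable fun s => M s a b) : Measurable fun s => gameValue (M s) :=
  continuous_gameValue.measurable.comp
    (measurable_pi_iff.2 fun a => measurable_pi_iff.2 fun b => hM a b)

end MatrixGame

/-! ### The class of estimated value functions and a finite net -/

section ValueClass

variable {S A B : Type*} {d : ℕ}

theorem clip_mem_Icc {m : ℝ} (hm : 0 ≤ m) (y : ℝ) : clip m y ∈ Set.Icc 0 m :=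
  ⟨le_min hm (le_max_right _ _), min_le_left _ _⟩

theorem clip_le_add {m y y' c : ℝ} (hc : 0 ≤ c) (h : y ≤ y' + c) : clip m y ≤ clip m y' + c := by
  unfold clip
  rcases le_total m (max y' 0) with h1 | h1
  · rw [min_eq_left h1]; exact (min_le_left _ _).trans (by linarith)
  · rw [min_eq_right h1]
    refine (min_le_right _ _).trans (max_le (by linarith [le_max_left y' 0]) ?_)
    linarith [le_max_right y' 0]

/-- There is no sign condition because a grid matrix need not be positive semidefinite; the real
square root is 0 on negative numbers. -/
theorem sqrt_le_sqrt_add_sqrt_abs_sub (a b : ℝ) : √a ≤ √b + √|a - b| := by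
  rw [Real.sqrt_le_left (by positivity), add_sq, Real.sq_sqrt (abs_nonneg _)]
  have h1 : b ≤ √b ^ 2 := by
    rcases le_total 0 b with hb | hb
    · rw [Real.sq_sqrt hb]
    · exact hb.trans (sq_nonneg _)
  have h2 : 0 ≤ 2 * √b * √|a - b| := by positivity
  linarith [le_abs_self (a - b)]

theorem abs_dotProduct_le {x y : Fin d → ℝ} {ε : ℝ} (hx : ∀ i, |x i| ≤ 1) (hy : ∀ i, |y i| ≤ ε) :
    |x ⬝ᵥ y| ≤ d * ε := by
  calc |x ⬝ᵥ y| ≤ ∑ i, |x i * y i| := Finset.abs_sum_le_sum_abs _ _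
    _ ≤ ∑ _i : Fin d, ε := Finset.sum_le_sum fun i _ => by
        rw [abs_mul]
        exact (mul_le_of_le_one_left (abs_nonneg _) (hx i)).trans (hy i)
    _ = d * ε := by simp

/-- Value at each state of the matrix game with payoffs `φᵀ w + σ √(φᵀ M φ)`, truncated at `m`. -/
noncomputable def quadValue [Fintype A] [MeasurableSpace A] [Fintype B]
    [MeasurableSpace B] (φ : S × A × B → Fin d → ℝ) (m σ : ℝ) (w : Fin d → ℝ)
    (M : Matrix (Fin d) (Fin d) ℝ) (s : S) : ℝ :=
  gameValue fun a b => clip m (φ (s, a, b) ⬝ᵥ w + σ * √(φ (s, a, b) ⬝ᵥ (M *ᵥ φ (s, a, b))))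

variable [Fintype A] [Nonempty A] [MeasurableSpace A] [MeasurableSingletonClass A]
  [Fintype B] [Nonempty B] [MeasurableSpace B] [MeasurableSingletonClass B]

theorem quadValue_mem_Icc (φ : S × A × B → Fin d → ℝ) {m : ℝ} (hm : 0 ≤ m) (σ : ℝ)
    (w : Fin d → ℝ) (M : Matrix (Fin d) (Fin d) ℝ) (s : S) :
    quadValue φ m σ w M s ∈ Set.Icc 0 m :=
  gameValue_mem_Icc fun _ _ => clip_mem_Icc hm _

theorem measurable_quadValue [MeasurableSpace S] {φ : S × A × B → Fin d → ℝ} (hφ : Measurable φ)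
    (m σ : ℝ) (w : Fin d → ℝ) (M : Matrix (Fin d) (Fin d) ℝ) : Measurable (quadValue φ m σ w M) := by
  refine measurable_gameValue fun a b => ?_
  have h1 : Measurable fun s => φ (s, a, b) := hφ.comp (by fun_prop)
  have h2 : Measurable fun s => φ (s, a, b) ⬝ᵥ w := measurable_dotProduct h1 measurable_const
  have h3 : Measurable fun s => φ (s, a, b) ⬝ᵥ (M *ᵥ φ (s, a, b)) :=
    measurable_dotProduct h1 (measurable_pi_iff.2 fun _ => measurable_dotProduct measurable_const h1)
  unfold clip
  fun_prop

/-- Game value and clipping are 1-Lipschitz. The linear term moves by at most dε. The quadratic form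
moves by at most d²ε, so its square root, which is only Hölder of exponent 1/2, moves by at most
d√ε. -/
theorem quadValue_le_add {φ : S × A × B → Fin d → ℝ} (hφ : ∀ z i, |φ z i| ≤ 1) (m : ℝ) {σ : ℝ}
    (hσ : |σ| = 1) {w w' : Fin d → ℝ} {M M' : Matrix (Fin d) (Fin d) ℝ} {ε : ℝ} (hε : 0 ≤ ε)
    (hw : ∀ i, |w i - w' i| ≤ ε) (hM : ∀ i j, |M i j - M' i j| ≤ ε) (s : S) :
    quadValue φ m σ w M s ≤ quadValue φ m σ w' M' s + (d * ε + d * √ε) := by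
  refine gameValue_le_add fun a b => clip_le_add (by positivity) ?_
  set x := φ (s, a, b)
  have hx : ∀ i, |x i| ≤ 1 := hφ _
  have h1 : |x ⬝ᵥ w - x ⬝ᵥ w'| ≤ d * ε := by
    rw [← dotProduct_sub]
    exact abs_dotProduct_le hx hw
  have h2 : |x ⬝ᵥ (M *ᵥ x) - x ⬝ᵥ (M' *ᵥ x)| ≤ (d * √ε) ^ 2 := by
    rw [← dotProduct_sub, ← Matrix.sub_mulVec, mul_pow, Real.sq_sqrt hε, sq, mul_assoc]
    refine abs_dotProduct_le hx fun i => ?_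
    rw [Matrix.mulVec, dotProduct_comm]
    exact abs_dotProduct_le hx fun j => hM i j
  have h3 := sqrt_le_sqrt_add_sqrt_abs_sub (x ⬝ᵥ (M *ᵥ x)) (x ⬝ᵥ (M' *ᵥ x))
  have h4 := sqrt_le_sqrt_add_sqrt_abs_sub (x ⬝ᵥ (M' *ᵥ x)) (x ⬝ᵥ (M *ᵥ x))
  rw [abs_sub_comm] at h4
  have h5 : √|x ⬝ᵥ (M *ᵥ x) - x ⬝ᵥ (M' *ᵥ x)| ≤ d * √ε :=
    Real.sqrt_le_iff.2 ⟨by positivity, h2⟩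
  have h6 := (abs_le.1 h1).2
  rcases eq_or_eq_neg_of_abs_eq hσ with rfl | rfl <;> linarith

/-- The vector encoded by an integer grid point, with mesh `ε`. -/
noncomputable def gridVec (ε : ℝ) (g : Fin d ⊕ Fin d × Fin d → ℤ) : Fin d → ℝ := fun i => ε * g (Sum.inl i)

/-- The matrix encoded by an integer grid point, with mesh `ε`. -/
noncomputable def gridMat (ε : ℝ) (g : Fin d ⊕ Fin d × Fin d → ℤ) : Matrix (Fin d) (Fin d) ℝ :=
  Matrix.of fun i j => ε * g (Sum.inr (i, j))

/-- The grid points with coordinates of absolute value at most `N`. -/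
noncomputable def grid (d N : ℕ) : Finset (Fin d ⊕ Fin d × Fin d → ℤ) :=
  Fintype.piFinset fun _ => Finset.Icc (-(N : ℤ)) N

theorem card_grid (d N : ℕ) : (grid d N).card = (2 * N + 1) ^ (d + d * d) := by
  rw [grid, Fintype.card_piFinset]
  rw [Finset.prod_const, Finset.card_univ]
  simp only [Int.card_Icc, Fintype.card_sum, Fintype.card_prod, Fintype.card_fin]
  congr 1
  omega

theorem exists_int_near {x R ε : ℝ} (hε : 0 < ε) (hx : |x| ≤ R) {N : ℕ} (hN : R / ε + 1 ≤ N) :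
    ∃ n : ℤ, n ∈ Finset.Icc (-(N : ℤ)) N ∧ |x - ε * n| ≤ ε := by
  have h0 := abs_le.1 hx
  have h1 := Int.floor_le (x / ε)
  have h2 := Int.lt_floor_add_one (x / ε)
  have h3 : x / ε ≤ R / ε := by gcongr; exact h0.2
  have h4 : -(R / ε) ≤ x / ε := by rw [← neg_div]; gcongr; exact h0.1
  -- Rounding down may leave [-R/ε, R/ε] by at most one unit, which the extra 1 in the bound on N
  -- pays for.
  refine ⟨⌊x / ε⌋, Finset.mem_Icc.2 ⟨?_, ?_⟩, ?_⟩
  · have : (-(N : ℝ)) ≤ ⌊x / ε⌋ := by linarith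
    exact_mod_cast this
  · have : (⌊x / ε⌋ : ℝ) ≤ N := by linarith
    exact_mod_cast this
  · rw [le_div_iff₀ hε] at h1
    rw [div_lt_iff₀ hε] at h2
    rw [abs_le]
    constructor <;> nlinarith

/-- The grid is a net of the class of functions `quadValue`. -/
theorem exists_grid_near {φ : S × A × B → Fin d → ℝ} (hφ : ∀ z i, |φ z i| ≤ 1) (m : ℝ) {σ : ℝ}
    (hσ : |σ| = 1) {w : Fin d → ℝ} {M : Matrix (Fin d) (Fin d) ℝ} {R ε : ℝ} (hε : 0 < ε)
    (hw : ∀ i, |w i| ≤ R) (hM : ∀ i j, |M i j| ≤ R) {N : ℕ} (hN : R / ε + 1 ≤ N) :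
    ∃ g ∈ grid d N, ∀ s, |quadValue φ m σ w M s - quadValue φ m σ (gridVec ε g) (gridMat ε g) s|
      ≤ d * ε + d * √ε := by
  choose n hn hn' using fun i => exists_int_near hε (hw i) hN
  choose k hk hk' using fun i j => exists_int_near hε (hM i j) hN
  refine ⟨Sum.elim n fun q => k q.1 q.2, ?_, fun s => abs_le.2 ⟨?_, ?_⟩⟩
  · rw [grid, Fintype.mem_piFinset]
    rintro (i | q)
    · exact hn i
    · exact hk q.1 q.2
  · rw [neg_le_sub_iff_le_add]
    exact quadValue_le_add hφ m hσ hε.le (fun i => by rw [abs_sub_comm]; exact hn' i)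
      (fun i j => by rw [abs_sub_comm]; exact hk' i j) s
  · rw [sub_le_iff_le_add']
    exact quadValue_le_add hφ m hσ hε.le hn' hk' s

end ValueClass

/-! ### Integration against signed measures -/

section SignedIntegral

variable {S : Type*} [MeasurableSpace S] {d : ℕ}

/-- Integral of a function against a signed measure. -/
noncomputable def signedIntegral (μ : SignedMeasure S) (V : S → ℝ) : ℝ :=
  ∫ s, V s ∂μ.toJordanDecomposition.posPart - ∫ s, V s ∂μ.toJordanDecomposition.negPart

theorem integrable_of_mem_Icc {V : S → ℝ} (hV : Measurable V) {m : ℝ}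
    (hm : ∀ s, V s ∈ Set.Icc 0 m) (ρ : Measure S) [IsFiniteMeasure ρ] : Integrable V ρ :=
  .of_mem_Icc 0 m hV.aemeasurable (ae_of_all _ hm)

theorem integral_mem_Icc {V : S → ℝ} (hV : Measurable V) {m : ℝ}
    (hm : ∀ s, V s ∈ Set.Icc 0 m) (ρ : Measure S) [IsFiniteMeasure ρ] :
    ∫ s, V s ∂ρ ∈ Set.Icc 0 (m * ρ.real Set.univ) := by
  refine ⟨integral_nonneg fun s => (hm s).1, ?_⟩
  calc ∫ s, V s ∂ρ ≤ ∫ _, m ∂ρ :=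
        integral_mono (integrable_of_mem_Icc hV hm ρ) (integrable_const _) fun s => (hm s).2
    _ = _ := by simp [mul_comm]

theorem abs_signedIntegral_le (μ : SignedMeasure S) {V : S → ℝ} (hV : Measurable V) {m : ℝ}
    (hm : ∀ s, V s ∈ Set.Icc 0 m) :
    |signedIntegral μ V| ≤ m * μ.totalVariation.real Set.univ := by
  have h1 := integral_mem_Icc hV hm μ.toJordanDecomposition.posPart
  have h2 := integral_mem_Icc hV hm μ.toJordanDecomposition.negPart
  have h3 : μ.totalVariation.real Set.univ = μ.toJordanDecomposition.posPart.real Set.univ +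
      μ.toJordanDecomposition.negPart.real Set.univ := by
    rw [SignedMeasure.totalVariation, measureReal_add_apply]
  rw [h3, mul_add]
  exact abs_sub_le_of_nonneg_of_le h1.1 (by linarith [h1.2, h2.1, h2.2]) h2.1
    (by linarith [h1.2, h1.1, h2.2])

/-- Integrals against a linear combination of signed measures. -/
theorem integral_eq_sum_signedIntegral (ρ : Measure S) [IsFiniteMeasure ρ] (x : Fin d → ℝ)
    (μ : Fin d → SignedMeasure S)
    (h : ∀ T, MeasurableSet T → ρ.real T = ∑ i, x i * μ i T) {V : S → ℝ} (hV : Measurable V)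
    {m : ℝ} (hm : ∀ s, V s ∈ Set.Icc 0 m) :
    ∫ s, V s ∂ρ = ∑ i, x i * signedIntegral (μ i) V := by
  set p := fun i => (μ i).toJordanDecomposition.posPart
  set n := fun i => (μ i).toJordanDecomposition.negPart
  have hμ : ∀ i T, MeasurableSet T → μ i T = (p i).real T - (n i).real T := by
    intro i T hT
    conv_lhs => rw [← (μ i).toSignedMeasure_toJordanDecomposition]
    rw [JordanDecomposition.toSignedMeasure, sub_apply,
      Measure.toSignedMeasure_apply_measurable hT, Measure.toSignedMeasure_apply_measurable hT]
  set a := fun i => (x i).toNNReal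
  set b := fun i => (-x i).toNNReal
  have hab : ∀ i, x i = a i - b i := by
    intro i
    rcases le_total 0 (x i) with h | h <;> simp [a, b, Real.coe_toNNReal', h]
  -- Coefficients and signed measures are split into positive and negative parts. With the negative
  -- terms moved to the left, the hypothesis becomes an equality of finite positive measures, which
  -- can be integrated.
  have hmeas : ρ + ∑ i, (b i • p i + a i • n i) = ∑ i, (a i • p i + b i • n i) := by
    ext T hT
    rw [← ENNReal.toReal_eq_toReal_iff' (measure_ne_top _ _) (measure_ne_top _ _)]
    simp only [Measure.add_apply, Measure.finsetSum_apply, Measure.smul_apply]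
    have hfin : ∀ (c : NNReal) (ρ' : Measure S) [IsFiniteMeasure ρ'], c • ρ' T ≠ ⊤ :=
      fun c ρ' _ => ENNReal.mul_ne_top ENNReal.coe_ne_top (measure_ne_top _ _)
    have hfin2 : ∀ (c c' : NNReal) (ρ₁ ρ₂ : Measure S) [IsFiniteMeasure ρ₁] [IsFiniteMeasure ρ₂],
        c • ρ₁ T + c' • ρ₂ T ≠ ⊤ :=
      fun c c' ρ₁ ρ₂ _ _ => ENNReal.add_ne_top.2 ⟨hfin c ρ₁, hfin c' ρ₂⟩
    rw [ENNReal.toReal_add (measure_ne_top _ _) (ENNReal.sum_ne_top.2 fun i _ => hfin2 _ _ _ _),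
      ENNReal.toReal_sum fun i _ => hfin2 _ _ _ _, ENNReal.toReal_sum fun i _ => hfin2 _ _ _ _]
    have h1 := h T hT
    rw [Measure.real] at h1
    rw [h1, ← Finset.sum_add_distrib]
    refine Finset.sum_congr rfl fun i _ => ?_
    rw [ENNReal.toReal_add (hfin _ _) (hfin _ _),
      ENNReal.toReal_add (hfin _ _) (hfin _ _), hμ i T hT]
    simp only [ENNReal.smul_def, smul_eq_mul, ENNReal.toReal_mul, ENNReal.coe_toReal, hab i,
      Measure.real]
    ring
  have hint : ∀ (ρ' : Measure S) [IsFiniteMeasure ρ'], Integrable V ρ' := fun ρ' _ =>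
    integrable_of_mem_Icc hV hm ρ'
  have h2 := congrArg (fun ρ' => ∫ s, V s ∂ρ') hmeas
  rw [integral_add_measure (hint _) (hint _), integral_finsetSum_measure fun i _ => hint _,
    integral_finsetSum_measure fun i _ => hint _] at h2
  simp only [integral_add_measure (hint _) (hint _), integral_smul_nnreal_measure] at h2
  rw [← eq_sub_iff_add_eq, ← Finset.sum_sub_distrib] at h2
  rw [h2]
  refine Finset.sum_congr rfl fun i _ => ?_
  rw [hab i, signedIntegral]
  simp only [NNReal.smul_def, smul_eq_mul]
  ring

end SignedIntegral

theorem uncertainty_nonneg {S A B : Type*} {K d : ℕ} (φ : S × A × B → Fin d → ℝ)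
    (D : Dataset K S A B) (h : ℕ) (z : S × A × B) : 0 ≤ uncertainty φ D h z := Real.sqrt_nonneg _

/-! ### Bellman backups and the error of ridge regression -/

section LinearGame

variable {S A B : Type*} [MeasurableSpace S] [MeasurableSpace A] [MeasurableSpace B]
  {G : MarkovGame S A B} {K d : ℕ} {φ : S × A × B → Fin d → ℝ}

theorem norm_toLp_mono {u t : Fin d → ℝ} {m : ℝ} (hm : 0 ≤ m) (h : ∀ i, |u i| ≤ m * t i) :
    ‖WithLp.toLp 2 u‖ ≤ m * ‖WithLp.toLp 2 t‖ := by
  have h1 : m * ‖WithLp.toLp 2 t‖ = ‖WithLp.toLp 2 (m • t)‖ := by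
    rw [WithLp.toLp_smul, norm_smul, Real.norm_of_nonneg hm]
  rw [h1, ← sqrt_dotProduct_self, ← sqrt_dotProduct_self]
  refine Real.sqrt_le_sqrt (Finset.sum_le_sum fun i _ => ?_)
  rw [← sq, ← sq]
  exact sq_le_sq.2 ((h i).trans (le_abs_self _))

theorem IsLinear.abs_feature_le (hG : IsLinear G φ) (z : S × A × B) (i : Fin d) : |φ z i| ≤ 1 :=
  (abs_apply_le_norm _ i).trans (hG.norm_feature_le z)

/-- Bellman backups of bounded functions are linear in the features. -/
theorem IsLinear.exists_backup_param (hG : IsLinear G φ) {h : ℕ} (hh : h ∈ Finset.Icc 1 G.H)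
    {V : S → ℝ} (hV : Measurable V) {m : ℝ} (hm0 : 0 ≤ m) (hm : ∀ s, V s ∈ Set.Icc 0 m) :
    ∃ η : Fin d → ℝ, ‖WithLp.toLp 2 η‖ ≤ (1 + m) * √d ∧
      ∀ z, G.reward h z + ∫ s, V s ∂(G.P h z) = φ z ⬝ᵥ η := by
  obtain ⟨θ, hθ, hr⟩ := hG.reward_linear h hh
  obtain ⟨μ, hμ, hP⟩ := hG.transition_linear h hh
  refine ⟨θ + fun i => signedIntegral (μ i) V, ?_, fun z => ?_⟩
  · rw [WithLp.toLp_add]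
    refine (norm_add_le _ _).trans ?_
    have := norm_toLp_mono hm0 (fun i => abs_signedIntegral_le (μ i) hV hm)
    have h2 : m * ‖WithLp.toLp 2 fun i => (μ i).totalVariation.real Set.univ‖ ≤ m * √d := by
      gcongr
    linarith
  · rw [dotProduct_add, ← hr z, integral_eq_sum_signedIntegral _ (φ z) μ (hP z) hV hm]
    rfl

/-- Centered and rescaled value of the next state. -/
noncomputable def transitionNoise (G : MarkovGame S A B) (h : ℕ) (c : ℝ) (V : S → ℝ)
    (q : (S × A × B) × (ℝ × S)) : ℝ :=
  (V q.2.2 - ∫ s, V s ∂(G.P h q.1)) / c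

theorem measurable_integral_transition {V : S → ℝ} (hV : Measurable V) (h : ℕ) :
    Measurable fun z => ∫ s, V s ∂(G.P h z) :=
  (StronglyMeasurable.integral_kernel (κ := G.P h) hV.stronglyMeasurable).measurable

theorem measurable_transitionNoise {V : S → ℝ} (hV : Measurable V) (h : ℕ) (c : ℝ) :
    Measurable (transitionNoise G h c V) := by
  exact ((hV.comp (by fun_prop)).sub
    ((measurable_integral_transition hV h).comp measurable_fst)).div_const c

theorem abs_transitionNoise_le {V : S → ℝ} (hV : Measurable V) (h : ℕ) {c : ℝ} (hc : 0 < c)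
    (hm : ∀ s, V s ∈ Set.Icc 0 c) (q : (S × A × B) × (ℝ × S)) :
    |transitionNoise G h c V q| ≤ 1 := by
  have h1 := integral_mem_Icc hV hm (G.P h q.1)
  rw [probReal_univ, mul_one] at h1
  rw [transitionNoise, abs_div, abs_of_pos hc, div_le_one hc]
  exact abs_sub_le_of_nonneg_of_le (hm _).1 (hm _).2 h1.1 h1.2

/-- The law of (reward, next state) as a kernel. -/
noncomputable def outcomeKernel (G : MarkovGame S A B) (h : ℕ) : Kernel (S × A × B) (ℝ × S) :=
  Kernel.deterministic (G.reward h) (G.reward_measurable h) ×ₖ G.P h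

instance (h : ℕ) : IsMarkovKernel (outcomeKernel G h) := by
  unfold outcomeKernel; infer_instance

theorem outcomeKernel_apply (h : ℕ) (z : S × A × B) : outcomeKernel G h z = outcomeLaw G h z := by
  rw [outcomeKernel, Kernel.prod_apply, Kernel.deterministic_apply, outcomeLaw]

theorem integral_transitionNoise {V : S → ℝ} (hV : Measurable V) (h : ℕ) {c : ℝ}
    (hm : ∀ s, V s ∈ Set.Icc 0 c) (z : S × A × B) :
    ∫ y, transitionNoise G h c V (z, y) ∂(outcomeKernel G h z) = 0 := by
  have hint := integrable_of_mem_Icc hV hm (G.P h z)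
  rw [outcomeKernel_apply, outcomeLaw, integral_prod]
  · simp [transitionNoise, integral_div, integral_sub hint (integrable_const _)]
  · exact ((hint.comp_snd _).sub (integrable_const (∫ s, V s ∂(G.P h z)))).div_const c

theorem IsLinear.uncertainty_le_one (hG : IsLinear G φ) (D : Dataset K S A B) (h : ℕ)
    (z : S × A × B) : uncertainty φ D h z ≤ 1 :=
  (sqrt_regGram_inv_le _ _ _).trans (hG.norm_feature_le z)

theorem norm_sum_smul_feature_le (hG : IsLinear G φ) (D : Dataset K S A B) (h : ℕ)
    {y : Fin K → ℝ} {c : ℝ} (hy : ∀ τ, |y τ| ≤ c) :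
    ‖WithLp.toLp 2 (∑ τ, y τ • φ (D.input h τ))‖ ≤ K * c := by
  rw [WithLp.toLp_sum]
  calc _ ≤ ∑ τ, ‖WithLp.toLp 2 (y τ • φ (D.input h τ))‖ := norm_sum_le _ _
    _ ≤ ∑ _τ : Fin K, c := by
        refine Finset.sum_le_sum fun τ _ => ?_
        rw [WithLp.toLp_smul, norm_smul, Real.norm_eq_abs]
        exact (mul_le_of_le_one_right (abs_nonneg _) (hG.norm_feature_le _)).trans (hy τ)
    _ = K * c := by simp

/-- Keeps the regression weights in the box covered by the grid: Λ⁻¹ does not increase norms, and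
each of the K targets is at most 1 + m. -/
theorem IsLinear.abs_ridge_apply_le (hG : IsLinear G φ) (D : Dataset K S A B) {h : ℕ}
    (hrew : ∀ τ, D.rew h τ = G.reward h (D.input h τ)) {V : S → ℝ} {m : ℝ}
    (hm : ∀ s, V s ∈ Set.Icc 0 m) (i : Fin d) : |ridge φ D h V i| ≤ K * (1 + m) := by
  refine (abs_apply_le_norm _ i).trans ((norm_regGram_inv_mulVec_le _ _ _).trans ?_)
  refine norm_sum_smul_feature_le hG D h fun τ => ?_
  have h1 := G.reward_mem h (D.input h τ)
  have h2 := hm (D.state (h + 1) τ)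
  rw [hrew, abs_of_nonneg (add_nonneg h1.1 h2.1)]
  exact add_le_add h1.2 h2.2

/-- Error of ridge regression in terms of the self-normalized noise of a nearby function. -/
theorem IsLinear.abs_ridge_sub_backup_le (hG : IsLinear G φ) (D : Dataset K S A B) {h : ℕ}
    (hh : h ∈ Finset.Icc 1 G.H) (hrew : ∀ τ, D.rew h τ = G.reward h (D.input h τ))
    {V V' : S → ℝ} (hV : Measurable V) (hV' : Measurable V') {m : ℝ} (hm0 : 0 < m)
    (hm : ∀ s, V s ∈ Set.Icc 0 m) (hm' : ∀ s, V' s ∈ Set.Icc 0 m) {ε : ℝ}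
    (hε : ∀ s, |V s - V' s| ≤ ε) {r : ℝ}
    (hnoise : noiseSum Finset.univ (fun τ => φ (D.input h τ))
        (fun τ => transitionNoise G h m V' (D.input h τ, D.outcome h τ)) ⬝ᵥ
      ((gram φ D h)⁻¹ *ᵥ noiseSum Finset.univ (fun τ => φ (D.input h τ))
        (fun τ => transitionNoise G h m V' (D.input h τ, D.outcome h τ))) ≤ r)
    (z : S × A × B) :
    |φ z ⬝ᵥ ridge φ D h V - (G.reward h z + ∫ s, V s ∂(G.P h z))| ≤
      (m * √r + 2 * K * ε + (1 + m) * √d) * uncertainty φ D h z := by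
  obtain ⟨η, hη, hback⟩ := hG.exists_backup_param hh hV hm0.le hm
  set v : Fin K → Fin d → ℝ := fun τ => φ (D.input h τ) with hv
  set W := (gram φ D h)⁻¹ with hW
  have hWp : W.PosSemidef := regGram_inv_posSemidef Finset.univ v
  set N := noiseSum Finset.univ v
    (fun τ => transitionNoise G h m V' (D.input h τ, D.outcome h τ)) with hN
  -- The cost, per sample, of replacing the noise of V by that of the nearby V', counting both the
  -- observed value and its conditional mean.
  set δ : Fin K → ℝ := fun τ => (V (D.state (h + 1) τ) - V' (D.state (h + 1) τ)) -
    ((∫ s, V s ∂(G.P h (D.input h τ))) - ∫ s, V' s ∂(G.P h (D.input h τ))) with hδ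
  have hδle : ∀ τ, |δ τ| ≤ 2 * ε := by
    intro τ
    have h1 := hε (D.state (h + 1) τ)
    have h2 : |(∫ s, V s ∂(G.P h (D.input h τ))) - ∫ s, V' s ∂(G.P h (D.input h τ))| ≤ ε := by
      rw [← integral_sub (integrable_of_mem_Icc hV hm _) (integrable_of_mem_Icc hV' hm' _)]
      have := norm_integral_le_of_norm_le_const (μ := G.P h (D.input h τ))
        (ae_of_all _ fun s => (Real.norm_eq_abs (V s - V' s)).trans_le (hε s))
      simpa using this
    rw [abs_le] at h1 h2 ⊢
    constructor <;> simp only [hδ] <;> linarith [h1.1, h1.2, h2.1, h2.2]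
  -- Writing η = Λ⁻¹Λη separates the error into Λ⁻¹ applied to noise, discretization and the bias -η
  -- caused by the regularizer. Cauchy–Schwarz in the Λ⁻¹-norm then factors out the uncertainty of
  -- z, and each part is bounded separately.
  have hridge : ridge φ D h V = W *ᵥ ((m • N + ∑ τ, δ τ • v τ) - η) + η := by
    have e1 : η = W *ᵥ (∑ τ, (v τ ⬝ᵥ η) • v τ + η) := by
      rw [← regGram_mulVec Finset.univ v η]
      exact (regGram_inv_mulVec Finset.univ v η).symm
    have e2 : W *ᵥ ((m • N + ∑ τ, δ τ • v τ) - η) + η =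
        W *ᵥ (m • N + ∑ τ, δ τ • v τ + ∑ τ, (v τ ⬝ᵥ η) • v τ) := by
      conv_lhs => rw [add_comm]; lhs; rw [e1]
      rw [← Matrix.mulVec_add]
      congr 1
      abel
    rw [e2, ridge]
    congr 1
    rw [hN, noiseSum, Finset.smul_sum, ← Finset.sum_add_distrib, ← Finset.sum_add_distrib]
    refine Finset.sum_congr rfl fun τ _ => ?_
    rw [smul_smul, ← add_smul, ← add_smul]
    congr 1
    rw [hv, ← hback, hrew, transitionNoise, hδ, mul_div_cancel₀ _ hm0.ne', Dataset.outcome]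
    ring
  have hsplit : φ z ⬝ᵥ ridge φ D h V - (G.reward h z + ∫ s, V s ∂(G.P h z)) =
      φ z ⬝ᵥ (W *ᵥ ((m • N + ∑ τ, δ τ • v τ) - η)) := by
    rw [hback, hridge, dotProduct_add]; ring
  rw [hsplit]
  refine (abs_dotProduct_mulVec_le hWp _ _).trans ?_
  rw [mul_comm]
  refine mul_le_mul_of_nonneg_right ?_ (Real.sqrt_nonneg _)
  rw [sub_eq_add_neg]
  refine (sqrt_quadForm_add_le hWp _ _).trans (add_le_add ?_ ?_)
  · refine (sqrt_quadForm_add_le hWp _ _).trans (add_le_add ?_ ?_)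
    · rw [Matrix.mulVec_smul, smul_dotProduct, dotProduct_smul, smul_eq_mul, smul_eq_mul,
        ← mul_assoc, Real.sqrt_mul (by positivity), Real.sqrt_mul_self hm0.le]
      gcongr
    · refine (sqrt_regGram_inv_le _ _ _).trans
        ((norm_sum_smul_feature_le hG D h hδle).trans_eq (by ring))
  · refine (sqrt_regGram_inv_le _ _ _).trans ?_
    rw [WithLp.toLp_neg, norm_neg]
    exact hη

end LinearGame

/-! ### The event on which the regression is accurate -/

section GoodEvent

variable {S A B Ω : Type*} [MeasurableSpace S] [MeasurableSpace A] [MeasurableSpace B]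
  {G : MarkovGame S A B} {K d : ℕ} {φ : S × A × B → Fin d → ℝ}

/-- Squared `Λ_h⁻¹`-norm of the rescaled Bellman noise of `V` on the dataset. -/
noncomputable def noiseForm (G : MarkovGame S A B) (φ : S × A × B → Fin d → ℝ)
    (D : Dataset K S A B) (h : ℕ) (c : ℝ) (V : S → ℝ) : ℝ :=
  noiseSum Finset.univ (fun τ => φ (D.input h τ))
      (fun τ => transitionNoise G h c V (D.input h τ, D.outcome h τ)) ⬝ᵥ
    ((gram φ D h)⁻¹ *ᵥ noiseSum Finset.univ (fun τ => φ (D.input h τ))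
      (fun τ => transitionNoise G h c V (D.input h τ, D.outcome h τ)))

theorem measurable_input_pastInfo (D : Ω → Dataset K S A B) (h : ℕ) {i j : Fin K} (hij : i ≤ j) :
    Measurable[pastInfo D h j] fun ω => (D ω).input h i :=
  Measurable.of_comap_le <| le_sup_of_le_left <| le_iSup₂_of_le i hij le_rfl

theorem measurable_outcome_pastInfo (D : Ω → Dataset K S A B) (h : ℕ) {i j : Fin K}
    (hij : i < j) : Measurable[pastInfo D h j] fun ω => (D ω).outcome h i :=
  Measurable.of_comap_le <| le_sup_of_le_right <| le_iSup₂_of_le i hij le_rfl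

variable [mΩ : MeasurableSpace Ω] {Pr : Measure Ω} {D : Ω → Dataset K S A B}

theorem IsCompliant.measurable_noiseForm (hD : IsCompliant Pr G D) (hφ : Measurable φ) {h : ℕ}
    (hh : h ∈ Finset.Icc 1 G.H) {V : S → ℝ} (hV : Measurable V) (c : ℝ) :
    Measurable fun ω => noiseForm G φ (D ω) h c V := by
  have h1 : ∀ τ ∈ (Finset.univ : Finset (Fin K)), Measurable fun ω => φ ((D ω).input h τ) :=
    fun τ _ => hφ.comp (hD.measurable_input h hh τ)
  have h2 : ∀ τ ∈ (Finset.univ : Finset (Fin K)), Measurable fun ω =>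
      transitionNoise G h c V ((D ω).input h τ, (D ω).outcome h τ) := fun τ _ =>
    (measurable_transitionNoise hV h c).comp
      ((hD.measurable_input h hh τ).prodMk (hD.measurable_outcome h hh τ))
  have h3 := measurable_noiseSum Finset.univ h1 h2
  exact measurable_regGram_inv_form Finset.univ h1 h3 h3

theorem IsCompliant.pastInfo_le (hD : IsCompliant Pr G D) {h : ℕ} (hh : h ∈ Finset.Icc 1 G.H)
    (τ : Fin K) : pastInfo D h τ ≤ mΩ := by
  refine sup_le (iSup₂_le fun i _ => ?_) (iSup₂_le fun i _ => ?_)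
  · exact (hD.measurable_input h hh i).comap_le
  · exact (hD.measurable_outcome h hh i).comap_le

theorem IsCompliant.condLaw_outcomeKernel (hD : IsCompliant Pr G D) {h : ℕ}
    (hh : h ∈ Finset.Icc 1 G.H) (τ : Fin K) (E : Set (ℝ × S)) (hE : MeasurableSet E) :
    Pr[Set.indicator {ω | (D ω).outcome h τ ∈ E} (fun _ => (1 : ℝ)) | pastInfo D h τ]
      =ᵐ[Pr] fun ω => (outcomeKernel G h ((D ω).input h τ)).real E := by
  simp only [outcomeKernel_apply]
  exact hD.cond_law h hh τ E hE

theorem IsCompliant.measure_noiseForm_ge_le [IsProbabilityMeasure Pr] (hD : IsCompliant Pr G D) (hG : IsLinear G φ)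
    {h : ℕ} (hh : h ∈ Finset.Icc 1 G.H) {V : S → ℝ} (hV : Measurable V) {c : ℝ} (hc : 0 < c)
    (hm : ∀ s, V s ∈ Set.Icc 0 c) {r : ℝ} (hdK : 0 < d + K) :
    Pr {ω | 2 * r + d * Real.log (d + K) ≤ noiseForm G φ (D ω) h c V}
      ≤ ENNReal.ofReal (Real.exp (-r)) :=
  measure_selfNormalized_gt_le (fun τ => hD.pastInfo_le hh τ)
    (fun _ _ hij => measurable_input_pastInfo D h hij)
    (fun _ _ hij => measurable_outcome_pastInfo D h hij)
    (fun τ => hD.measurable_outcome h hh τ) (outcomeKernel G h)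
    (fun τ => hD.condLaw_outcomeKernel hh τ) hG.measurable_feature hG.norm_feature_le
    (measurable_transitionNoise hV h c) (abs_transitionNoise_le hV h hc hm)
    (integral_transitionNoise hV h hm) hdK

theorem IsCompliant.measurableSet_rew_eq (hD : IsCompliant Pr G D) {h : ℕ}
    (hh : h ∈ Finset.Icc 1 G.H) (τ : Fin K) :
    MeasurableSet {ω | (D ω).rew h τ = G.reward h ((D ω).input h τ)} :=
  measurableSet_eq_fun (measurable_fst.comp (hD.measurable_outcome h hh τ))
    ((G.reward_measurable h).comp (hD.measurable_input h hh τ))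

/-- Conditionally on the input the reward has a Dirac law, so a wrong reward has conditional
probability 0. The regression noise thus comes from the transitions alone. -/
theorem IsCompliant.ae_rew_eq [IsProbabilityMeasure Pr] (hD : IsCompliant Pr G D) {h : ℕ}
    (hh : h ∈ Finset.Icc 1 G.H) (τ : Fin K) :
    ∀ᵐ ω ∂Pr, (D ω).rew h τ = G.reward h ((D ω).input h τ) := by
  have hR := G.reward_measurable h
  have hs : MeasurableSet {q : (S × A × B) × (ℝ × S) | q.2.1 ≠ G.reward h q.1} :=
    (measurableSet_eq_fun (measurable_fst.comp measurable_snd) (hR.comp measurable_fst)).compl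
  have hind : Measurable (Set.indicator
      {q : (S × A × B) × (ℝ × S) | q.2.1 ≠ G.reward h q.1} fun _ => (1 : ENNReal)) :=
    measurable_const.indicator hs
  have key := lintegral_eq_of_condLaw (hD.pastInfo_le hh τ)
    (measurable_input_pastInfo D h le_rfl) (measurable_input_pastInfo D h le_rfl)
    (hD.measurable_outcome h hh τ) (outcomeKernel G h) (hD.condLaw_outcomeKernel hh τ)
    (f := Set.indicator {q : (S × A × B) × (ℝ × S) | q.2.1 ≠ G.reward h q.1} fun _ => 1)
    hind
  have hzero : ∀ z, ∫⁻ y, Set.indicator {q : (S × A × B) × (ℝ × S) | q.2.1 ≠ G.reward h q.1}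
      (fun _ => (1 : ENNReal)) (z, y) ∂(outcomeKernel G h z) = 0 := by
    intro z
    have hm : Measurable fun y : ℝ × S =>
        Set.indicator {q : (S × A × B) × (ℝ × S) | q.2.1 ≠ G.reward h q.1}
          (fun _ => (1 : ENNReal)) (z, y) :=
      hind.comp measurable_prodMk_left
    rw [outcomeKernel_apply, outcomeLaw, lintegral_prod _ hm.aemeasurable, lintegral_dirac']
    · simp
    · exact hm.lintegral_prod_right'
  simp only [hzero, lintegral_zero] at key
  have hcomp := hind.comp
    ((hD.measurable_input h hh τ).prodMk (hD.measurable_outcome h hh τ))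
  replace key := (lintegral_eq_zero_iff hcomp).1 key
  filter_upwards [key] with ω hω
  by_contra hne
  simp [Dataset.outcome, hne] at hω

variable [Fintype A] [Nonempty A] [MeasurableSingletonClass A]
  [Fintype B] [Nonempty B] [MeasurableSingletonClass B]

/-- The dataset reports the true rewards, and the Bellman noise of all value functions of a grid is
small. -/
structure IsAccurate (G : MarkovGame S A B) (φ : S × A × B → Fin d → ℝ) (D : Dataset K S A B)
    (ε : ℝ) (N : ℕ) (r : ℝ) : Prop where
  rew_eq : ∀ h ∈ Finset.Icc 1 G.H, ∀ τ, D.rew h τ = G.reward h (D.input h τ)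
  noise_le : ∀ h ∈ Finset.Icc 1 G.H, ∀ σ ∈ ({1, -1} : Finset ℝ), ∀ g ∈ grid d N,
    noiseForm G φ D h G.H (quadValue φ ((G.H : ℝ) - h) σ (gridVec ε g) (gridMat ε g)) ≤ r

theorem sub_cast_nonneg_of_mem_Icc {h H : ℕ} (hh : h ∈ Finset.Icc 1 H) : (0 : ℝ) ≤ (H : ℝ) - h :=
  sub_nonneg.2 (by exact_mod_cast (Finset.mem_Icc.1 hh).2)

theorem Icc_sub_subset (H h : ℕ) : Set.Icc (0 : ℝ) ((H : ℝ) - h) ⊆ Set.Icc 0 (H : ℝ) :=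
  Set.Icc_subset_Icc_right (sub_le_self _ (Nat.cast_nonneg h))

/-- Union bound over H steps, two signs and (2N+1)^(d+d²) grid points. The grid functions do not
depend on the data, so the concentration bound applies to each; false rewards cost probability 0. -/
theorem IsCompliant.exists_accurate_event [IsProbabilityMeasure Pr] (hD : IsCompliant Pr G D) (hG : IsLinear G φ)
    (hdK : 0 < d + K) (ε : ℝ) (N : ℕ) (r : ℝ) :
    ∃ E : Set Ω, MeasurableSet E ∧
      1 - 2 * G.H * (2 * N + 1) ^ (d + d * d) * Real.exp (-r) ≤ Pr.real E ∧
      ∀ ω ∈ E, IsAccurate G φ (D ω) ε N (2 * r + d * Real.log (d + K)) := by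
  set V : ℕ → ℝ → (Fin d ⊕ Fin d × Fin d → ℤ) → S → ℝ := fun h σ g =>
    quadValue φ ((G.H : ℝ) - h) σ (gridVec ε g) (gridMat ε g) with hVdef
  have hVm : ∀ h σ g, Measurable (V h σ g) := fun h σ g =>
    measurable_quadValue hG.measurable_feature _ _ _ _
  set R : Set Ω := ⋃ h ∈ Finset.Icc 1 G.H, ⋃ τ : Fin K,
    {ω | (D ω).rew h τ = G.reward h ((D ω).input h τ)}ᶜ with hR
  set F : Set Ω := ⋃ h ∈ Finset.Icc 1 G.H, ⋃ σ ∈ ({1, -1} : Finset ℝ), ⋃ g ∈ grid d N,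
    {ω | 2 * r + d * Real.log (d + K) ≤ noiseForm G φ (D ω) h G.H (V h σ g)} with hF
  have hRm : MeasurableSet R := Finset.measurableSet_biUnion _ fun h hh =>
    MeasurableSet.iUnion fun τ => (hD.measurableSet_rew_eq hh τ).compl
  have hFm : MeasurableSet F := Finset.measurableSet_biUnion _ fun h hh =>
    Finset.measurableSet_biUnion _ fun σ _ => Finset.measurableSet_biUnion _ fun g _ =>
      measurableSet_le measurable_const
        (hD.measurable_noiseForm hG.measurable_feature hh (hVm h σ g) _)
  have hR0 : Pr R = 0 := by
    refine (measure_biUnion_null_iff (Finset.countable_toSet _)).2 fun h hh => ?_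
    exact measure_iUnion_null fun τ => hD.ae_rew_eq hh τ
  have hF0 : Pr F ≤ ENNReal.ofReal (2 * G.H * (2 * N + 1) ^ (d + d * d) * Real.exp (-r)) := by
    calc Pr F ≤ ∑ h ∈ Finset.Icc 1 G.H, ∑ σ ∈ ({1, -1} : Finset ℝ), ∑ g ∈ grid d N,
          ENNReal.ofReal (Real.exp (-r)) := by
          refine (measure_biUnion_finset_le _ _).trans (Finset.sum_le_sum fun h hh => ?_)
          refine (measure_biUnion_finset_le _ _).trans (Finset.sum_le_sum fun σ hσ => ?_)
          refine (measure_biUnion_finset_le _ _).trans (Finset.sum_le_sum fun g hg => ?_)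
          have hH : (0 : ℝ) < G.H := by
            have := Finset.mem_Icc.1 hh
            exact_mod_cast this.1.trans this.2
          exact hD.measure_noiseForm_ge_le hG hh (hVm h σ g) hH
            (fun s => Icc_sub_subset _ _
              (quadValue_mem_Icc φ (sub_cast_nonneg_of_mem_Icc hh) _ _ _ s)) hdK
      _ = _ := by
          have hc : ({1, -1} : Finset ℝ).card = 2 := by
            rw [Finset.card_pair]; norm_num
          simp only [Finset.sum_const, card_grid, hc, Nat.card_Icc, nsmul_eq_mul]
          rw [ENNReal.ofReal_mul (by positivity)]
          have : (2 * G.H * (2 * N + 1) ^ (d + d * d) : ℝ) =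
            ((2 * G.H * (2 * N + 1) ^ (d + d * d) : ℕ) : ℝ) := by push_cast; ring
          rw [this, ENNReal.ofReal_natCast]
          push_cast
          ring
  refine ⟨(R ∪ F)ᶜ, (hRm.union hFm).compl, ?_, fun ω hω => ?_⟩
  · rw [probReal_compl_eq_one_sub (hRm.union hFm)]
    refine sub_le_sub_left ?_ _
    refine ENNReal.toReal_le_of_le_ofReal (by positivity) ?_
    refine (measure_union_le _ _).trans ?_
    rwa [hR0, zero_add]
  · simp only [hR, hF, Set.mem_compl_iff, Set.mem_union, Set.mem_iUnion, not_or, not_exists,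
      Set.mem_ofPred_eq, not_not, not_le] at hω
    exact ⟨fun h hh τ => hω.1 h hh τ, fun h hh σ hσ g hg => (hω.2 h hh σ hσ g hg).le⟩

/-- On an accurate dataset, ridge regression estimates the Bellman backup of every value function
of the class. -/
theorem IsAccurate.abs_ridge_sub_backup_le {D : Dataset K S A B} {ε : ℝ} {N : ℕ} {r : ℝ}
    (hA : IsAccurate G φ D ε N r) (hG : IsLinear G φ) (hε : 0 < ε) {h : ℕ}
    (hh : h ∈ Finset.Icc 1 G.H) {σ : ℝ} (hσ : σ ∈ ({1, -1} : Finset ℝ)) {w : Fin d → ℝ}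
    {M : Matrix (Fin d) (Fin d) ℝ} {R : ℝ} (hw : ∀ i, |w i| ≤ R) (hM : ∀ i j, |M i j| ≤ R)
    (hN : R / ε + 1 ≤ N) (z : S × A × B) :
    |φ z ⬝ᵥ ridge φ D h (quadValue φ ((G.H : ℝ) - h) σ w M) -
        (G.reward h z + ∫ s, quadValue φ ((G.H : ℝ) - h) σ w M s ∂(G.P h z))| ≤
      (G.H * √r + 2 * K * (d * ε + d * √ε) + (1 + G.H) * √d) * uncertainty φ D h z := by
  have hσ1 : |σ| = 1 := by
    simp only [Finset.mem_insert, Finset.mem_singleton] at hσ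
    rcases hσ with rfl | rfl <;> simp
  obtain ⟨g, hg, hnear⟩ := exists_grid_near hG.abs_feature_le ((G.H : ℝ) - h) hσ1 hε hw hM hN
  have hH : (0 : ℝ) < G.H := by
    have := Finset.mem_Icc.1 hh
    exact_mod_cast this.1.trans this.2
  have hmem : ∀ w M s, quadValue φ ((G.H : ℝ) - h) σ w M s ∈ Set.Icc (0 : ℝ) G.H := fun w M s =>
    Icc_sub_subset _ _ (quadValue_mem_Icc φ (sub_cast_nonneg_of_mem_Icc hh) _ _ _ s)
  exact hG.abs_ridge_sub_backup_le D hh (hA.rew_eq h hh)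
    (measurable_quadValue hG.measurable_feature _ _ _ _)
    (measurable_quadValue hG.measurable_feature _ _ _ _) hH (hmem _ _) (hmem _ _) hnear
    (hA.noise_le h hh σ hσ g hg) z

end GoodEvent

/-! ### The bonus dominates the error: numerical estimates -/

section Bonus

/-- The term 2 log c is absorbed by log c ≤ c and log ζ ≥ log 2 ≥ 1/2. The bound is linear in c,
which suffices against a bonus whose square is quadratic in c. -/
theorem log_le_of_le_sq_mul_pow_five {c ζ x : ℝ} (hc : 1 ≤ c) (hζ : 2 ≤ ζ) (hx0 : 0 < x)
    (hx : x ≤ c ^ 2 * ζ ^ 5) : Real.log x ≤ (4 * c + 5) * Real.log ζ := by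
  have h1 := Real.log_le_log hx0 hx
  rw [Real.log_mul (by positivity) (by positivity), Real.log_pow, Real.log_pow] at h1
  have h2 : Real.log c ≤ c := (Real.log_le_sub_one_of_pos (by linarith)).trans (by linarith)
  have h3 : (1 / 2 : ℝ) ≤ Real.log ζ := by
    have := Real.log_le_log (by norm_num) hζ
    linarith [Real.log_two_gt_d9]
  push_cast at h1
  nlinarith

/-- Used with a = dH, b = dK, q = HK. The grid depends on β and so on the logarithm L, but L ≤ ζ
makes everything polynomial in ζ, and after taking logarithms no circularity is left. -/
theorem net_size_le {N a b q c ζ L β ε R : ℝ} (hζ : 2 ≤ ζ) (hLζ : L ≤ ζ) (hL : 0 ≤ L)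
    (hc : 100 ≤ c) (ha0 : 0 ≤ a) (hb0 : 0 ≤ b) (ha : 2 * a ≤ ζ) (hb : 2 * b ≤ ζ) (hq : 2 * q ≤ ζ)
    (hβ : β ^ 2 = c ^ 2 * a ^ 2 * L) (hε : ε = 1 / b ^ 2) (hR : R = 2 * q + β ^ 2)
    (hN : N ≤ R / ε + 2) : 2 * N + 1 ≤ c ^ 2 * ζ ^ 5 := by
  have hc2 : (100 : ℝ) ≤ c ^ 2 := by nlinarith
  have ha2 : a ^ 2 ≤ ζ ^ 2 / 4 := by nlinarith
  have hb2 : b ^ 2 ≤ ζ ^ 2 / 4 := by nlinarith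
  have hβle : β ^ 2 ≤ c ^ 2 * ζ ^ 3 / 4 := by
    calc β ^ 2 = c ^ 2 * (a ^ 2 * L) := by rw [hβ]; ring
      _ ≤ c ^ 2 * (ζ ^ 2 / 4 * ζ) := by gcongr
      _ = _ := by ring
  have hRle : R ≤ c ^ 2 * ζ ^ 3 / 2 := by
    have h3 : ζ ≤ ζ ^ 3 := le_self_pow₀ (by linarith) (by norm_num)
    have h4 : 4 * ζ ^ 3 ≤ c ^ 2 * ζ ^ 3 := by gcongr; linarith
    linarith
  have h1 : R / ε = R * b ^ 2 := by rw [hε, div_div_eq_mul_div, div_one]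
  have h3 : R * b ^ 2 ≤ c ^ 2 * ζ ^ 5 / 8 := by
    calc R * b ^ 2 ≤ c ^ 2 * ζ ^ 3 / 2 * (ζ ^ 2 / 4) := by gcongr
      _ = _ := by ring
  have h6 : (1 : ℝ) ≤ ζ ^ 5 := one_le_pow₀ (by linarith)
  have h7 : 100 * 1 ≤ c ^ 2 * ζ ^ 5 := by gcongr
  linarith

/-- The left side is at most (16c + 23) d² L, and 16c + 23 ≤ c²/4 for c ≥ 100. This is where c has
to be large. -/
theorem radius_le {d l x y c L r : ℝ} (hd : 1 ≤ d) (hL : 0 ≤ L) (hc : 100 ≤ c)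
    (hl : l ≤ (4 * c + 5) * L) (hl0 : 0 ≤ l) (hx : x ≤ L) (hy : y ≤ L)
    (hr : r = x + (d + d * d) * l) : 2 * r + d * y ≤ (c / 2 * d * √L) ^ 2 := by
  have hdd : d ≤ d ^ 2 := le_self_pow₀ hd (by norm_num)
  have hd2 : 1 ≤ d ^ 2 := one_le_pow₀ hd
  have h5 : (d + d * d) * l ≤ 2 * d ^ 2 * ((4 * c + 5) * L) := by
    gcongr
    linarith [sq d]
  have h1 : d * y ≤ d ^ 2 * L := by
    calc d * y ≤ d * L := by gcongr
      _ ≤ d ^ 2 * L := by gcongr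
  have h2 : L ≤ d ^ 2 * L := le_mul_of_one_le_left hL hd2
  have h4 : (c / 2 * d * √L) ^ 2 = (d ^ 2 * L) * (c ^ 2 / 4) := by
    rw [mul_pow, mul_pow, Real.sq_sqrt hL]; ring
  rw [h4]
  calc 2 * r + d * y ≤ (d ^ 2 * L) * (16 * c + 23) := by rw [hr]; linarith
    _ ≤ _ := by
      gcongr
      nlinarith

/-- The confidence radius dominates all error terms of the regression. -/
theorem error_le_bonus {d K H N : ℕ} (hd : 1 ≤ d) (hK : 1 ≤ K) (hH : 1 ≤ H) {p c β ε R r : ℝ}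
    (hp : 0 < p) (hp1 : p < 1) (hc : 100 ≤ c)
    (hβ : β = c * d * H * √(Real.log (2 * d * K * H / p))) (hε : ε = 1 / ((d : ℝ) * K) ^ 2)
    (hR : R = 2 * H * K + β ^ 2) (hN : (N : ℝ) ≤ R / ε + 2)
    (hr : r = Real.log (2 * H * (2 * N + 1) ^ (d + d * d) / p)) :
    H * √(2 * r + d * Real.log (d + K)) + 2 * K * (d * ε + d * √ε) + (1 + H) * √d ≤ β := by
  have hd' : (1 : ℝ) ≤ d := by exact_mod_cast hd
  have hK' : (1 : ℝ) ≤ K := by exact_mod_cast hK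
  have hH' : (1 : ℝ) ≤ H := by exact_mod_cast hH
  obtain ⟨ζ, hζ⟩ : ∃ ζ : ℝ, ζ = 2 * d * K * H / p := ⟨_, rfl⟩
  obtain ⟨L, hL⟩ : ∃ L, L = Real.log ζ := ⟨_, rfl⟩
  rw [← hζ, ← hL] at hβ
  have hdK : (1 : ℝ) ≤ d * K := one_le_mul_of_one_le_of_one_le hd' hK'
  have hdH : (1 : ℝ) ≤ d * H := one_le_mul_of_one_le_of_one_le hd' hH'
  have hHK : (1 : ℝ) ≤ H * K := one_le_mul_of_one_le_of_one_le hH' hK'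
  have hζ1 : 2 * d * K * H ≤ ζ := by
    rw [hζ, le_div_iff₀ hp]
    exact mul_le_of_le_one_right (by positivity) hp1.le
  have hζdK : 2 * (d * K) ≤ ζ := by
    linarith [le_mul_of_one_le_right (a := (d * K : ℝ)) (by positivity) hH']
  have hζdH : 2 * (d * H) ≤ ζ := by
    linarith [le_mul_of_one_le_right (a := (d * H : ℝ)) (by positivity) hK']
  have hζHK : 2 * (H * K) ≤ ζ := by
    linarith [le_mul_of_one_le_right (a := (H * K : ℝ)) (by positivity) hd']
  have hζ2 : 2 ≤ ζ := by linarith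
  have hLpos : (0.64 : ℝ) ≤ L := by
    have := Real.log_le_log (by norm_num) hζ2
    rw [hL]
    linarith [Real.log_two_gt_d9]
  have hLζ : L ≤ ζ := hL.trans_le <| (Real.log_le_sub_one_of_pos (by linarith)).trans (by linarith)
  have hNle : 2 * (N : ℝ) + 1 ≤ c ^ 2 * ζ ^ 5 := by
    refine net_size_le (a := d * H) (b := d * K) (q := H * K) (β := β) hζ2 hLζ (by linarith) hc
      (by positivity) (by positivity) hζdH hζdK hζHK ?_ hε (by rw [hR]; ring) hN
    rw [hβ, mul_pow, Real.sq_sqrt (by linarith)]; ring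
  have hlogN : Real.log (2 * N + 1) ≤ (4 * c + 5) * L := hL ▸
    log_le_of_le_sq_mul_pow_five (by linarith) hζ2 (by positivity) hNle
  have hlogH : Real.log (2 * H / p) ≤ L := by
    rw [hL]
    refine Real.log_le_log (by positivity) ?_
    rw [hζ]
    refine div_le_div_of_nonneg_right ?_ hp.le
    calc 2 * (H : ℝ) ≤ 2 * H * (d * K) := le_mul_of_one_le_right (by positivity) hdK
      _ = _ := by ring
  have hreq : r = Real.log (2 * H / p) + (d + d * d) * Real.log (2 * N + 1) := by
    have h2 : (2 * H * (2 * N + 1) ^ (d + d * d) / p : ℝ) =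
        2 * H / p * (2 * N + 1) ^ (d + d * d) := by ring
    rw [hr, h2, Real.log_mul (by positivity) (by positivity), Real.log_pow]
    push_cast
    rfl
  have hlogdK : Real.log (d + K) ≤ L := by
    rw [hL]
    refine Real.log_le_log (by positivity) (le_trans ?_ hζdK)
    linarith [mul_nonneg (sub_nonneg.2 hd') (sub_nonneg.2 hK')]
  have hX : 2 * r + d * Real.log (d + K) ≤ (c / 2 * d * √L) ^ 2 :=
    radius_le hd' (by linarith) hc hlogN
      (Real.log_nonneg (by linarith [Nat.cast_nonneg (α := ℝ) N])) hlogH hlogdK hreq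
  have hsX : √(2 * r + d * Real.log (d + K)) ≤ c / 2 * d * √L :=
    Real.sqrt_le_iff.2 ⟨by positivity, hX⟩
  have hεs : √ε = 1 / (d * K) := by
    rw [hε, Real.sqrt_div zero_le_one, Real.sqrt_one, Real.sqrt_sq (by positivity)]
  -- The mesh ε = (dK)⁻² is chosen so that d√ε = 1/K, which cancels the factor K coming from the sum
  -- over samples.
  have hcov : 2 * K * (d * ε + d * √ε) ≤ 4 := by
    have h1 : ε ≤ √ε := by
      rw [hεs, hε]
      exact one_div_le_one_div_of_le (by positivity) (le_self_pow₀ hdK (by norm_num))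
    have h2 : d * √ε = 1 / K := by rw [hεs]; field_simp
    have h3 : d * ε ≤ 1 / K := by rw [← h2]; gcongr
    calc 2 * K * (d * ε + d * √ε) ≤ 2 * K * (1 / K + 1 / K) := by rw [h2]; gcongr
      _ = 4 := by field_simp; norm_num
  have hsd : √d ≤ d := Real.sqrt_le_iff.2 ⟨by positivity, le_self_pow₀ hd' (by norm_num)⟩
  have hsL : (0.8 : ℝ) ≤ √L := Real.le_sqrt_of_sq_le (by norm_num; linarith)
  have hlast : (1 + H) * √d ≤ 2 * (d * H) := by
    calc (1 + H) * √d ≤ (2 * H) * d := by gcongr; linarith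
      _ = _ := by ring
  -- One half of β pays for the noise. The other half pays for discretization and bias, together at
  -- most 6dH, since c√L/2 ≥ 40.
  calc _ ≤ H * (c / 2 * d * √L) + 4 + 2 * (d * H) := by gcongr
    _ ≤ H * (c / 2 * d * √L) + 6 * (d * H) := by linarith
    _ ≤ H * (c / 2 * d * √L) + (c / 2 * √L) * (d * H) := by
        gcongr
        linarith [mul_le_mul hc hsL (by norm_num) (by linarith)]
    _ = β := by rw [hβ]; ring

end Bonus

theorem integrable_of_abs_le {X : Type*} [MeasurableSpace X] {f : X → ℝ} (hf : Measurable f)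
    {C : ℝ} (hC : ∀ x, |f x| ≤ C) (μ : Measure X) [IsFiniteMeasure μ] : Integrable f μ :=
  .of_bound hf.aestronglyMeasurable C (ae_of_all _ hC)

/-! ### Bellman equation and comparison principles -/

section Dynamics

variable {S A B : Type*} [MeasurableSpace S] [MeasurableSpace A] [MeasurableSpace B]
  (G : MarkovGame S A B) (π : Policy S A) (ν : Policy S B)

instance (h : ℕ) : IsMarkovKernel (actLaw π ν h) := by
  unfold actLaw; infer_instance

instance (h n : ℕ) : IsMarkovKernel (stateLaw G π ν h n) := by
  induction n with
  | zero => unfold stateLaw; infer_instance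
  | succ n ih => unfold stateLaw; infer_instance

/-- The definition of `stateLaw` splits off the last transition, whereas the Bellman equation
conditions on the first one. -/
theorem stateLaw_succ' (h n : ℕ) :
    stateLaw G π ν h (n + 1) = stateLaw G π ν (h + 1) n ∘ₖ (G.P h ∘ₖ actLaw π ν h) := by
  induction n with
  | zero => simp [stateLaw, Kernel.id_comp, Kernel.comp_id]
  | succ n ih =>
    rw [stateLaw, ih, stateLaw, Kernel.comp_assoc, Kernel.comp_assoc, Kernel.comp_assoc,
      show h + (n + 1) = h + 1 + n by omega]

variable {G π ν} {f : S × A × B → ℝ}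

theorem measurable_expect (hf : Measurable f) (h k : ℕ) : Measurable (expect G π ν h k f) :=
  (StronglyMeasurable.integral_kernel (κ := actLaw π ν k ∘ₖ stateLaw G π ν h (k - h))
    hf.stronglyMeasurable).measurable

theorem abs_expect_le {C : ℝ} (hC : ∀ z, |f z| ≤ C) (h k : ℕ) (s : S) :
    |expect G π ν h k f s| ≤ C := by
  have := norm_integral_le_of_norm_le_const
    (μ := (actLaw π ν k ∘ₖ stateLaw G π ν h (k - h)) s)
    (ae_of_all _ fun z => (Real.norm_eq_abs (f z)).trans_le (hC z))
  simpa [expect] using this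

theorem expect_succ (hf : Measurable f) {C : ℝ} (hC : ∀ z, |f z| ≤ C) {h k : ℕ} (hk : h < k)
    (s : S) : expect G π ν h k f s =
      ∫ z, ∫ s', expect G π ν (h + 1) k f s' ∂(G.P h z) ∂(actLaw π ν h s) := by
  have e : k - h = (k - (h + 1)) + 1 := by omega
  unfold expect
  rw [e, stateLaw_succ', ← Kernel.comp_assoc, ← Kernel.comp_assoc,
    Kernel.integral_comp (integrable_of_abs_le ?_ ?_ _ (C := C))]
  · refine integral_congr_ae (ae_of_all _ fun z => ?_)
    exact Kernel.integral_comp (integrable_of_abs_le hf hC _)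
  · exact hf
  · exact hC

variable (G π ν) in
/-- Expected cumulative reward from step `h` on, for arbitrary rewards. -/
noncomputable def cumulative (f : ℕ → S × A × B → ℝ) (h : ℕ) (s : S) : ℝ :=
  ∑ k ∈ Finset.Icc h G.H, expect G π ν h k (f k) s

variable {f : ℕ → S × A × B → ℝ} {C : ℝ}

theorem measurable_cumulative (hf : ∀ k, Measurable (f k)) (h : ℕ) :
    Measurable (cumulative G π ν f h) :=
  Finset.measurable_sum _ fun k _ => measurable_expect (hf k) h k

theorem abs_cumulative_le (hC : ∀ k z, |f k z| ≤ C) (h : ℕ) (s : S) :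
    |cumulative G π ν f h s| ≤ (Finset.Icc h G.H).card * C := by
  refine (Finset.abs_sum_le_sum_abs _ _).trans ?_
  rw [← nsmul_eq_mul]
  exact Finset.sum_le_card_nsmul _ _ _ fun k _ => abs_expect_le (hC k) h k s

theorem cumulative_eq_zero {h : ℕ} (hh : G.H < h) (s : S) : cumulative G π ν f h s = 0 := by
  simp [cumulative, Finset.Icc_eq_empty (not_le.2 hh)]

theorem cumulative_add_const_mul {g : ℕ → S × A × B → ℝ} {C' : ℝ} (hf : ∀ k, Measurable (f k))
    (hC : ∀ k z, |f k z| ≤ C) (hg : ∀ k, Measurable (g k)) (hC' : ∀ k z, |g k z| ≤ C') (t : ℝ)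
    (h : ℕ) (s : S) : cumulative G π ν (fun k z => f k z + t * g k z) h s =
      cumulative G π ν f h s + t * cumulative G π ν g h s := by
  rw [cumulative, cumulative, cumulative, Finset.mul_sum, ← Finset.sum_add_distrib]
  refine Finset.sum_congr rfl fun k _ => ?_
  rw [expect, expect, expect, integral_add (integrable_of_abs_le (hf k) (hC k) _)
    ((integrable_of_abs_le (hg k) (hC' k) _).const_mul t), integral_const_mul]

variable [Fintype A] [MeasurableSingletonClass A] [Fintype B] [MeasurableSingletonClass B]

theorem integral_actLaw {g : S × A × B → ℝ} (hg : Measurable g) {C : ℝ}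
    (hC : ∀ z, |g z| ≤ C) (h : ℕ) (s : S) :
    ∫ z, g z ∂(actLaw π ν h s) =
      payoff (fun a b => g (s, a, b)) (π.kernel h s) (ν.kernel h s) := by
  rw [actLaw, Kernel.prod_apply, Kernel.prod_apply, Kernel.id_apply,
    integral_prod _ (integrable_of_abs_le hg hC _), integral_dirac']
  · exact integral_prod _ .of_finite
  · exact (hg.stronglyMeasurable.integral_prod_right' (ν := (π.kernel h s).prod (ν.kernel h s)))

/-- Bellman equation. -/
theorem cumulative_eq_payoff (hf : ∀ k, Measurable (f k)) (hC : ∀ k z, |f k z| ≤ C) {h : ℕ}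
    (hh : h ≤ G.H) (s : S) :
    cumulative G π ν f h s = payoff (fun a b => f h (s, a, b) +
      ∫ s', cumulative G π ν f (h + 1) s' ∂(G.P h (s, a, b))) (π.kernel h s) (ν.kernel h s) := by
  have hm := measurable_integral_transition (G := G) (measurable_cumulative (G := G) (π := π)
    (ν := ν) hf (h + 1)) h
  have hb : ∀ z, |∫ s', cumulative G π ν f (h + 1) s' ∂(G.P h z)| ≤
      (Finset.Icc (h + 1) G.H).card * C := by
    intro z
    have := norm_integral_le_of_norm_le_const (μ := G.P h z)
      (ae_of_all _ fun s' => (Real.norm_eq_abs _).trans_le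
        (abs_cumulative_le (G := G) (π := π) (ν := ν) hC (h + 1) s'))
    simpa using this
  rw [payoff_add, ← integral_actLaw (hf h) (hC h), ← integral_actLaw hm hb, cumulative,
    ← Finset.add_sum_Ioc_eq_sum_Icc hh]
  congr 1
  · rw [expect, Nat.sub_self, stateLaw, Kernel.comp_id]
  · rw [show Finset.Ioc h G.H = Finset.Icc (h + 1) G.H by ext; simp]
    have hint : ∀ k z, Integrable (expect G π ν (h + 1) k (f k)) (G.P h z) := fun k z =>
      integrable_of_abs_le (measurable_expect (hf k) _ _) (abs_expect_le (hC k) _ _) _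
    have e1 : ∀ z, ∫ s', cumulative G π ν f (h + 1) s' ∂(G.P h z) =
        ∑ k ∈ Finset.Icc (h + 1) G.H, ∫ s', expect G π ν (h + 1) k (f k) s' ∂(G.P h z) :=
      fun z => integral_finsetSum _ fun k _ => hint k z
    simp only [e1]
    rw [integral_finsetSum]
    · refine Finset.sum_congr rfl fun k hk => ?_
      exact expect_succ (hf k) (hC k) (Finset.mem_Icc.1 hk).1 s
    · intro k _
      refine integrable_of_abs_le
        (measurable_integral_transition (measurable_expect (hf k) _ _) h) (C := C) (fun z => ?_) _
      have := norm_integral_le_of_norm_le_const (μ := G.P h z)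
        (ae_of_all _ fun s' => (Real.norm_eq_abs _).trans_le
          (abs_expect_le (G := G) (π := π) (ν := ν) (hC k) (h + 1) k s'))
      simpa using this

/-- Functions that satisfy the Bellman equation with `≤` are below the cumulative reward. -/
theorem le_cumulative (hf : ∀ k, Measurable (f k)) (hC : ∀ k z, |f k z| ≤ C) {v : ℕ → S → ℝ}
    (hv : ∀ h, h ∈ Finset.Icc 1 (G.H + 1) → Measurable (v h))
    {C' : ℝ} (hC' : ∀ h, h ∈ Finset.Icc 1 (G.H + 1) → ∀ s, |v h s| ≤ C')
    (h0 : ∀ s, v (G.H + 1) s ≤ 0)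
    (hstep : ∀ h ∈ Finset.Icc 1 G.H, ∀ s, v h s ≤ payoff (fun a b => f h (s, a, b) +
      ∫ s', v (h + 1) s' ∂(G.P h (s, a, b))) (π.kernel h s) (ν.kernel h s))
    {h : ℕ} (h1 : 1 ≤ h) (hH : h ≤ G.H + 1) (s : S) : v h s ≤ cumulative G π ν f h s := by
  induction hH using Nat.decreasingInduction generalizing s with
  | self => rw [cumulative_eq_zero (Nat.lt_succ_self _)]; exact h0 s
  | of_succ h hh ih =>
    have hh' : h ≤ G.H := Nat.lt_succ_iff.1 hh
    refine (hstep h (Finset.mem_Icc.2 ⟨h1, hh'⟩) s).trans ?_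
    rw [cumulative_eq_payoff hf hC hh']
    refine payoff_mono (fun a b => ?_) _ _
    have hmem : h + 1 ∈ Finset.Icc 1 (G.H + 1) := Finset.mem_Icc.2 ⟨by omega, by omega⟩
    gcongr
    · exact integrable_of_abs_le (hv _ hmem) (hC' _ hmem) _
    · exact integrable_of_abs_le (measurable_cumulative hf _) (abs_cumulative_le hC _) _
    · exact fun s' => ih (by omega) s'

/-- Functions that satisfy the Bellman equation with `≥` are above the cumulative reward. -/
theorem cumulative_le (hf : ∀ k, Measurable (f k)) (hC : ∀ k z, |f k z| ≤ C) {v : ℕ → S → ℝ}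
    (hv : ∀ h, h ∈ Finset.Icc 1 (G.H + 1) → Measurable (v h))
    {C' : ℝ} (hC' : ∀ h, h ∈ Finset.Icc 1 (G.H + 1) → ∀ s, |v h s| ≤ C')
    (h0 : ∀ s, 0 ≤ v (G.H + 1) s)
    (hstep : ∀ h ∈ Finset.Icc 1 G.H, ∀ s, payoff (fun a b => f h (s, a, b) +
      ∫ s', v (h + 1) s' ∂(G.P h (s, a, b))) (π.kernel h s) (ν.kernel h s) ≤ v h s)
    {h : ℕ} (h1 : 1 ≤ h) (hH : h ≤ G.H + 1) (s : S) : cumulative G π ν f h s ≤ v h s := by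
  induction hH using Nat.decreasingInduction generalizing s with
  | self => rw [cumulative_eq_zero (Nat.lt_succ_self _)]; exact h0 s
  | of_succ h hh ih =>
    have hh' : h ≤ G.H := Nat.lt_succ_iff.1 hh
    refine le_trans ?_ (hstep h (Finset.mem_Icc.2 ⟨h1, hh'⟩) s)
    rw [cumulative_eq_payoff hf hC hh']
    refine payoff_mono (fun a b => ?_) _ _
    have hmem : h + 1 ∈ Finset.Icc 1 (G.H + 1) := Finset.mem_Icc.2 ⟨by omega, by omega⟩
    gcongr
    · exact integrable_of_abs_le (measurable_cumulative hf _) (abs_cumulative_le hC _) _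
    · exact integrable_of_abs_le (hv _ hmem) (hC' _ hmem) _
    · exact fun s' => ih (by omega) s'

end Dynamics

/-- As y lies in the clipping range, clipping preserves the side on which q ± u lies relative to y
and never increases the distance to y, which is at most 2u. -/
theorem clip_mem_of_abs_sub_le {m q y u : ℝ} (hy : y ∈ Set.Icc 0 m) (h : |q - y| ≤ u) :
    (clip m (q - u) ≤ y ∧ y ≤ clip m (q - u) + 2 * u) ∧
      (y ≤ clip m (q + u) ∧ clip m (q + u) ≤ y + 2 * u) := by
  rw [abs_le] at h
  unfold clip
  refine ⟨⟨(min_le_right _ _).trans (max_le (by linarith) hy.1), ?_⟩,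
    le_min hy.2 ((by linarith : y ≤ q + u).trans (le_max_left _ _)),
    (min_le_right _ _).trans (max_le (by linarith) (by linarith [hy.1]))⟩
  rw [← sub_le_iff_le_add]
  exact le_min (by linarith [hy.2]) ((by linarith : y - 2 * u ≤ q - u).trans (le_max_left _ _))

/-- The coefficient β is absorbed into the matrix β²Λ⁻¹, so that the class `quadValue` only needs a
sign σ besides its vector and matrix. -/
theorem sqrt_smul_quadForm {S A B : Type*} {K d : ℕ} {φ : S × A × B → Fin d → ℝ}
    {D : Dataset K S A B} {β : ℝ} (hβ : 0 ≤ β) (h : ℕ) (z : S × A × B) :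
    √(φ z ⬝ᵥ ((β ^ 2 • (gram φ D h)⁻¹) *ᵥ φ z)) = β * uncertainty φ D h z := by
  rw [Matrix.smul_mulVec, dotProduct_smul, smul_eq_mul, Real.sqrt_mul (by positivity),
    Real.sqrt_sq hβ, uncertainty]

theorem quadValue_zero {S A B : Type*} [Fintype A] [Nonempty A] [MeasurableSpace A]
    [MeasurableSingletonClass A] [Fintype B] [Nonempty B] [MeasurableSpace B]
    [MeasurableSingletonClass B] {d : ℕ} (φ : S × A × B → Fin d → ℝ) (σ : ℝ) (s : S) : quadValue φ 0 σ 0 0 s = 0 := by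
  have := quadValue_mem_Icc φ le_rfl σ 0 0 s
  simpa using this

/-! ### The estimated value functions belong to the class -/

section Estimates

variable {S A B : Type*} [MeasurableSpace S] [MeasurableSpace A] [MeasurableSpace B]
  {G : MarkovGame S A B} {K d : ℕ} {φ : S × A × B → Fin d → ℝ} {D : Dataset K S A B} {H : ℕ}
  {β σ : ℝ} {π : Policy S A} {ν : Policy S B}

theorem measurable_uncertainty (hφ : Measurable φ) (h : ℕ) : Measurable (uncertainty φ D h) :=
  (measurable_regGram_inv_form (Ω := S × A × B) Finset.univ (v := fun _ τ => φ (D.input h τ))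
    (fun _ _ => measurable_const) hφ hφ).sqrt

theorem IsLinear.abs_uncertainty_le (hG : IsLinear G φ) (h : ℕ) (z : S × A × B) :
    |uncertainty φ D h z| ≤ 1 := by
  rw [abs_of_nonneg (uncertainty_nonneg φ D h z)]
  exact hG.uncertainty_le_one D h z

theorem backup_mem_Icc {V : S → ℝ} (hV : Measurable V) {m : ℝ} (hm : ∀ s, V s ∈ Set.Icc 0 m)
    (h : ℕ) (z : S × A × B) :
    G.reward h z + ∫ s, V s ∂(G.P h z) ∈ Set.Icc 0 (m + 1) := by
  have h1 := integral_mem_Icc hV hm (G.P h z)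
  rw [probReal_univ, mul_one] at h1
  have h2 := G.reward_mem h z
  exact ⟨add_nonneg h2.1 h1.1, by linarith [h1.2, h2.2]⟩

/-- The policies play equilibria of the matrix games of all steps, for the bonus coefficient
`κ`. -/
def PlaysEquilibria (H : ℕ) (φ : S × A × B → Fin d → ℝ) (D : Dataset K S A B) (κ : ℝ)
    (π : Policy S A) (ν : Policy S B) : Prop :=
  ∀ h ∈ Finset.Icc 1 H, ∀ s : S,
    IsMatrixNash (fun a b => estQ H φ D κ h (estV H φ D κ π ν (H - h)) (s, a, b))
      (π.kernel h s) (ν.kernel h s)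

theorem estV_eq_payoff {κ : ℝ} {h : ℕ} (hh : h ∈ Finset.Icc 1 H) (s : S) :
    estV H φ D κ π ν (H - h + 1) s =
      payoff (fun a b => estQ H φ D κ h (estV H φ D κ π ν (H - h)) (s, a, b))
        (π.kernel h s) (ν.kernel h s) := by
  rw [estV, Nat.sub_sub_self (Finset.mem_Icc.1 hh).2]

/-- The bonus dominates the regression error of the estimated value functions. -/
def BonusDominates (G : MarkovGame S A B) (φ : S × A × B → Fin d → ℝ) (D : Dataset K S A B)
    (β : ℝ) (v : ℕ → S → ℝ) : Prop :=
  ∀ h ∈ Finset.Icc 1 G.H, ∀ z, |φ z ⬝ᵥ ridge φ D h (v (G.H - h)) -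
    (G.reward h z + ∫ s, v (G.H - h) s ∂(G.P h z))| ≤ β * uncertainty φ D h z

variable [Fintype A] [Nonempty A] [MeasurableSingletonClass A]
  [Fintype B] [Nonempty B] [MeasurableSingletonClass B]

/-- The equilibrium payoff is the game value and depends on the estimated Q-function only. Hence one
event serves all choices of equilibria at once. -/
theorem PlaysEquilibria.estV_eq_quadValue (hN : PlaysEquilibria H φ D (σ * β) π ν) (hβ : 0 ≤ β)
    {h : ℕ} (hh : h ∈ Finset.Icc 1 H) :
    estV H φ D (σ * β) π ν (H - h + 1) = quadValue φ ((H : ℝ) - h + 1) σ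
      (ridge φ D h (estV H φ D (σ * β) π ν (H - h))) (β ^ 2 • (gram φ D h)⁻¹) := by
  funext s
  rw [estV_eq_payoff hh, (hN h hh s).payoff_eq_gameValue, quadValue]
  congr 1
  funext a b
  rw [estQ, sqrt_smul_quadForm hβ, mul_assoc]

theorem PlaysEquilibria.estV_regular (hN : PlaysEquilibria H φ D (σ * β) π ν) (hβ : 0 ≤ β)
    (hφ : Measurable φ) {n : ℕ} (hn : n ≤ H) : Measurable (estV H φ D (σ * β) π ν n) ∧
      ∀ s, estV H φ D (σ * β) π ν n s ∈ Set.Icc (0 : ℝ) n := by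
  cases n with
  | zero => exact ⟨measurable_const, fun s => ⟨le_rfl, by simp [estV]⟩⟩
  | succ n =>
    have hh : H - n ∈ Finset.Icc 1 H := Finset.mem_Icc.2 ⟨by omega, by omega⟩
    have e := hN.estV_eq_quadValue hβ hh
    rw [show H - (H - n) + 1 = n + 1 by omega, Nat.sub_sub_self (by omega : n ≤ H)] at e
    rw [e]
    have hcast : (H : ℝ) - (H - n : ℕ) + 1 = n + 1 := by
      rw [Nat.cast_sub (by omega)]; ring
    refine ⟨measurable_quadValue hφ _ _ _ _, fun s => ?_⟩
    rw [hcast, Nat.cast_succ]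
    exact quadValue_mem_Icc φ (by positivity) _ _ _ s

/-- The estimate of the next value function lies in the class covered by the grid. -/
theorem PlaysEquilibria.exists_next_eq_quadValue (hN : PlaysEquilibria G.H φ D (σ * β) π ν)
    (hβ : 0 ≤ β) (hG : IsLinear G φ)
    (hrew : ∀ h ∈ Finset.Icc 1 G.H, ∀ τ, D.rew h τ = G.reward h (D.input h τ)) {h : ℕ}
    (hh : h ∈ Finset.Icc 1 G.H) :
    ∃ (w : Fin d → ℝ) (M : Matrix (Fin d) (Fin d) ℝ),
      (∀ i, |w i| ≤ 2 * G.H * K + β ^ 2) ∧ (∀ i j, |M i j| ≤ 2 * G.H * K + β ^ 2) ∧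
      estV G.H φ D (σ * β) π ν (G.H - h) = quadValue φ ((G.H : ℝ) - h) σ w M := by
  have hle := Finset.mem_Icc.1 hh
  rcases hle.2.eq_or_lt with rfl | hlt
  -- At the last step the next value is 0. It is still in the class, because clipping at m = H - h =
  -- 0 forces the value 0.
  · refine ⟨0, 0, fun i => ?_, fun i j => ?_, ?_⟩
    · simp; positivity
    · simp; positivity
    · funext s
      rw [Nat.sub_self, sub_self, quadValue_zero, estV]
  · have hh' : h + 1 ∈ Finset.Icc 1 G.H := Finset.mem_Icc.2 ⟨by omega, hlt⟩
    have e := hN.estV_eq_quadValue hβ hh'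
    rw [show G.H - (h + 1) + 1 = G.H - h by omega] at e
    refine ⟨ridge φ D (h + 1) (estV G.H φ D (σ * β) π ν (G.H - (h + 1))),
      β ^ 2 • (gram φ D (h + 1))⁻¹, fun i => ?_, fun i j => ?_, e.trans ?_⟩
    · have h1 := hG.abs_ridge_apply_le D (hrew _ hh')
        (hN.estV_regular hβ hG.measurable_feature (Nat.sub_le G.H (h + 1))).2 i
      have h0 : ((G.H - (h + 1) : ℕ) : ℝ) ≤ G.H := by exact_mod_cast Nat.sub_le _ _
      have h2 : (1 : ℝ) ≤ G.H := by exact_mod_cast hle.1.trans hle.2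
      have h3 : (K : ℝ) * (1 + (G.H - (h + 1) : ℕ)) ≤ K * (2 * G.H) := by gcongr; linarith
      linarith [sq_nonneg β]
    · rw [Matrix.smul_apply, smul_eq_mul, abs_mul, abs_of_nonneg (sq_nonneg β)]
      have h1 : β ^ 2 * |(gram φ D (h + 1))⁻¹ i j| ≤ β ^ 2 :=
        mul_le_of_le_one_right (sq_nonneg β) (abs_regGram_inv_apply_le _ _ i j)
      have h2 : (0 : ℝ) ≤ 2 * G.H * K := by positivity
      linarith
    · push_cast
      rw [sub_add_eq_sub_sub, sub_add_cancel]

theorem IsAccurate.bonusDominates {ε : ℝ} {N : ℕ} {r : ℝ}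
    (hA : IsAccurate G φ D ε N r) (hG : IsLinear G φ) (hε : 0 < ε) (hβ : 0 ≤ β)
    (hσ : σ ∈ ({1, -1} : Finset ℝ)) (hN : PlaysEquilibria G.H φ D (σ * β) π ν)
    (hNε : (2 * G.H * K + β ^ 2) / ε + 1 ≤ N)
    (hle : G.H * √r + 2 * K * (d * ε + d * √ε) + (1 + G.H) * √d ≤ β) :
    BonusDominates G φ D β (estV G.H φ D (σ * β) π ν) := by
  intro h hh z
  obtain ⟨w, M, hw, hM, e⟩ := hN.exists_next_eq_quadValue hβ hG hA.rew_eq hh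
  rw [e]
  refine (hA.abs_ridge_sub_backup_le hG hε hh hσ hw hM hNε z).trans ?_
  exact mul_le_mul_of_nonneg_right hle (uncertainty_nonneg φ D h z)

end Estimates

/-! ### From pessimism and optimism to the duality gap -/

section Suboptimality

variable {S A B : Type*} [MeasurableSpace S] [MeasurableSpace A] [MeasurableSpace B]
  {G : MarkovGame S A B} {K d : ℕ} {φ : S × A × B → Fin d → ℝ} {D : Dataset K S A B}
  {β : ℝ} {π π₁ : Policy S A} {ν ν₁ : Policy S B} {x : S}

theorem totalUncertainty_eq_cumulative (x : S) :
    totalUncertainty G φ D π ν x = cumulative G π ν (uncertainty φ D) 1 x := rfl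

theorem abs_reward_le (k : ℕ) (z : S × A × B) : |G.reward k z| ≤ 1 := by
  rw [abs_of_nonneg (G.reward_mem k z).1]
  exact (G.reward_mem k z).2

theorem IsLinear.abs_totalUncertainty_le (hG : IsLinear G φ) (D : Dataset K S A B)
    (π : Policy S A) (ν : Policy S B) (x : S) :
    |totalUncertainty G φ D π ν x| ≤ (Finset.Icc 1 G.H).card * 1 :=
  abs_cumulative_le (fun k z => hG.abs_uncertainty_le k z) 1 x

theorem bddAbove_range_of_abs_le {ι : Type*} {f : ι → ℝ} {C : ℝ} (h : ∀ i, |f i| ≤ C) :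
    BddAbove (Set.range f) :=
  ⟨C, by rintro _ ⟨i, rfl⟩; exact (abs_le.1 (h i)).2⟩

/-- The real suprema are genuine because each uncertainty is at most 1, so the sums over the steps
are bounded. -/
theorem IsLinear.totalUncertainty_le_relUncertaintyOf (hG : IsLinear G φ) (D : Dataset K S A B)
    (π π₁ : Policy S A) (ν ν₁ : Policy S B) (x : S) :
    totalUncertainty G φ D π ν₁ x ≤ relUncertaintyOf G φ D π ν x ∧
      totalUncertainty G φ D π₁ ν x ≤ relUncertaintyOf G φ D π ν x :=
  ⟨(le_ciSup (bddAbove_range_of_abs_le fun ν₁ => hG.abs_totalUncertainty_le D π ν₁ x) ν₁).trans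
      (le_max_left _ _),
    (le_ciSup (bddAbove_range_of_abs_le fun π₁ => hG.abs_totalUncertainty_le D π₁ ν x) π₁).trans
      (le_max_right _ _)⟩

theorem estV_step {κ : ℝ} {h : ℕ} (hh : h ∈ Finset.Icc 1 G.H) (s : S) :
    estV G.H φ D κ π ν (G.H + 1 - h) s =
      payoff (fun a b => estQ G.H φ D κ h (estV G.H φ D κ π ν (G.H - h)) (s, a, b))
        (π.kernel h s) (ν.kernel h s) := by
  rw [← estV_eq_payoff hh, Nat.sub_add_comm (Finset.mem_Icc.1 hh).2]

/-- Treating a multiple of the bonus as extra reward turns a bound with accumulated bonuses into a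
plain Bellman comparison. -/
theorem IsLinear.cumulative_reward_add_mul_uncertainty (hG : IsLinear G φ) (t : ℝ) (h : ℕ) (x : S) :
    cumulative G π ν (fun k z => G.reward k z + t * uncertainty φ D k z) h x =
      value G π ν h x + t * cumulative G π ν (uncertainty φ D) h x :=
  cumulative_add_const_mul G.reward_measurable abs_reward_le
    (measurable_uncertainty hG.measurable_feature) (fun k z => hG.abs_uncertainty_le k z) t h x

theorem IsLinear.abs_reward_add_mul_uncertainty_le (hG : IsLinear G φ) (t : ℝ) (k : ℕ)
    (z : S × A × B) : |G.reward k z + t * uncertainty φ D k z| ≤ 1 + |t| := by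
  refine (abs_add_le _ _).trans (add_le_add (abs_reward_le k z) ?_)
  rw [abs_mul]
  exact mul_le_of_le_one_right (abs_nonneg t) (hG.abs_uncertainty_le k z)

theorem IsLinear.measurable_reward_add_mul_uncertainty (hG : IsLinear G φ) (t : ℝ) (k : ℕ) :
    Measurable fun z => G.reward k z + t * uncertainty φ D k z :=
  (G.reward_measurable k).add ((measurable_uncertainty hG.measurable_feature k).const_mul t)

/-- Both sides are compared with the equilibrium value. For H = 0 the equilibrium condition is void,
but all values are empty sums. -/
theorem IsNash.value_le_value (hNash : IsNash G π ν) (π₁ : Policy S A) (ν₁ : Policy S B) (x : S) :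
    value G π₁ ν 1 x ≤ value G π ν₁ 1 x := by
  rcases Nat.eq_zero_or_pos G.H with h0 | hpos
  · simp [value, h0]
  · have := hNash 1 (Finset.mem_Icc.2 ⟨le_rfl, hpos⟩) x
    exact (this.1 π₁).trans (this.2 ν₁)

theorem dualityGap_eq_zero_of_horizon_eq_zero (hH : G.H = 0) (π : Policy S A) (ν : Policy S B)
    (x : S) : dualityGap G π ν x = 0 := by
  have : Nonempty (Policy S A) := ⟨π⟩
  have : Nonempty (Policy S B) := ⟨ν⟩
  simp [dualityGap, value, hH]

/-- A linear game with at least one step and one state has positive feature dimension. -/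
theorem IsLinear.dim_pos [Nonempty A] [Nonempty B] (hG : IsLinear G φ) (hH : 0 < G.H) (s : S) : 0 < d := by
  rcases Nat.eq_zero_or_pos d with rfl | h
  · obtain ⟨μ, -, hP⟩ := hG.transition_linear 1 (Finset.mem_Icc.2 ⟨le_rfl, hH⟩)
    -- For d = 0 the total transition probability would be an empty sum, that is, 0.
    have := hP (s, Classical.arbitrary A, Classical.arbitrary B) Set.univ MeasurableSet.univ
    simp at this
  · exact h

variable [Fintype A] [Nonempty A] [MeasurableSingletonClass A]
  [Fintype B] [Nonempty B] [MeasurableSingletonClass B] {σ : ℝ}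

theorem PlaysEquilibria.regular (hN : PlaysEquilibria G.H φ D (σ * β) π ν) (hβ : 0 ≤ β)
    (hφ : Measurable φ) : ∀ h ∈ Finset.Icc 1 (G.H + 1),
      Measurable (estV G.H φ D (σ * β) π ν (G.H + 1 - h)) ∧
      ∀ s, |estV G.H φ D (σ * β) π ν (G.H + 1 - h) s| ≤ G.H := by
  intro h hh
  have hle := Finset.mem_Icc.1 hh
  have hn : G.H + 1 - h ≤ G.H := by omega
  obtain ⟨h1, h2⟩ := hN.estV_regular hβ hφ hn
  refine ⟨h1, fun s => ?_⟩
  rw [abs_of_nonneg (h2 s).1]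
  exact (h2 s).2.trans (by exact_mod_cast hn)

theorem PlaysEquilibria.backup_mem_Icc (hN : PlaysEquilibria G.H φ D (σ * β) π ν) (hβ : 0 ≤ β)
    (hφ : Measurable φ) {h : ℕ} (hh : h ∈ Finset.Icc 1 G.H) (z : S × A × B) :
    G.reward h z + ∫ s, estV G.H φ D (σ * β) π ν (G.H - h) s ∂(G.P h z) ∈
      Set.Icc (0 : ℝ) ((G.H : ℝ) - h + 1) := by
  obtain ⟨h1, h2⟩ := hN.estV_regular hβ hφ (Nat.sub_le G.H h)
  rw [← Nat.cast_sub (Finset.mem_Icc.1 hh).2]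
  exact ZeroSumMG.backup_mem_Icc h1 h2 h z

/-- Pessimism: the lower estimate of the Q-function is below the Bellman backup, by at most twice
the bonus. -/
theorem PlaysEquilibria.estQ_lower (hN : PlaysEquilibria G.H φ D (-1 * β) π ν) (hβ : 0 ≤ β)
    (hφ : Measurable φ) (hB : BonusDominates G φ D β (estV G.H φ D (-1 * β) π ν)) {h : ℕ}
    (hh : h ∈ Finset.Icc 1 G.H) (z : S × A × B) :
    estQ G.H φ D (-1 * β) h (estV G.H φ D (-1 * β) π ν (G.H - h)) z ≤
        G.reward h z + ∫ s, estV G.H φ D (-1 * β) π ν (G.H - h) s ∂(G.P h z) ∧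
      G.reward h z + ∫ s, estV G.H φ D (-1 * β) π ν (G.H - h) s ∂(G.P h z) ≤
        estQ G.H φ D (-1 * β) h (estV G.H φ D (-1 * β) π ν (G.H - h)) z +
          2 * β * uncertainty φ D h z := by
  have := (clip_mem_of_abs_sub_le (hN.backup_mem_Icc hβ hφ hh z) (hB h hh z)).1
  rw [estQ, mul_assoc, neg_one_mul (β * _), ← sub_eq_add_neg, mul_assoc 2]
  exact this

/-- Optimism: the upper estimate of the Q-function is above the Bellman backup, by at most twice
the bonus. -/
theorem PlaysEquilibria.estQ_upper (hN : PlaysEquilibria G.H φ D (1 * β) π ν) (hβ : 0 ≤ β)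
    (hφ : Measurable φ) (hB : BonusDominates G φ D β (estV G.H φ D (1 * β) π ν)) {h : ℕ}
    (hh : h ∈ Finset.Icc 1 G.H) (z : S × A × B) :
    G.reward h z + ∫ s, estV G.H φ D (1 * β) π ν (G.H - h) s ∂(G.P h z) ≤
        estQ G.H φ D (1 * β) h (estV G.H φ D (1 * β) π ν (G.H - h)) z ∧
      estQ G.H φ D (1 * β) h (estV G.H φ D (1 * β) π ν (G.H - h)) z ≤
        G.reward h z + ∫ s, estV G.H φ D (1 * β) π ν (G.H - h) s ∂(G.P h z) +
          2 * β * uncertainty φ D h z := by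
  have := (clip_mem_of_abs_sub_le (hN.backup_mem_Icc hβ hφ hh z) (hB h hh z)).2
  rw [estQ, mul_assoc, one_mul (β * _), mul_assoc 2]
  exact this

/-- In the lower game ν minimizes against π, so playing ν₁ instead can only raise the payoff.
Pessimism then bounds the payoff by the Bellman backup, and `le_cumulative` iterates this. -/
theorem PlaysEquilibria.lower_le_value (hN : PlaysEquilibria G.H φ D (-1 * β) π ν) (hβ : 0 ≤ β)
    (hφ : Measurable φ) (hB : BonusDominates G φ D β (estV G.H φ D (-1 * β) π ν))
    (ν₁ : Policy S B) (x : S) : estV G.H φ D (-1 * β) π ν G.H x ≤ value G π ν₁ 1 x := by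
  refine le_cumulative (v := fun h => estV G.H φ D (-1 * β) π ν (G.H + 1 - h))
    G.reward_measurable abs_reward_le (fun h hh => (hN.regular hβ hφ h hh).1)
    (fun h hh => (hN.regular hβ hφ h hh).2) (fun s => by simp [estV]) (fun h hh s => ?_)
    le_rfl (by omega) x
  simp only [Nat.add_sub_add_right]
  rw [estV_step hh]
  exact ((hN h hh s).2 _ inferInstance).trans
    (payoff_mono (fun a b => (hN.estQ_lower hβ hφ hB hh _).1) _ _)

theorem PlaysEquilibria.value_le_upper (hN : PlaysEquilibria G.H φ D (1 * β) π ν) (hβ : 0 ≤ β)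
    (hφ : Measurable φ) (hB : BonusDominates G φ D β (estV G.H φ D (1 * β) π ν))
    (π₁ : Policy S A) (x : S) : value G π₁ ν 1 x ≤ estV G.H φ D (1 * β) π ν G.H x := by
  refine cumulative_le (v := fun h => estV G.H φ D (1 * β) π ν (G.H + 1 - h))
    G.reward_measurable abs_reward_le (fun h hh => (hN.regular hβ hφ h hh).1)
    (fun h hh => (hN.regular hβ hφ h hh).2) (fun s => by simp [estV]) (fun h hh s => ?_)
    le_rfl (by omega) x
  simp only [Nat.add_sub_add_right]
  rw [estV_step hh]
  exact (payoff_mono (fun a b => (hN.estQ_upper hβ hφ hB hh _).1) _ _).trans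
    ((hN h hh s).1 _ inferInstance)

/-- Here the maximizer deviates, which can only lower the payoff of the lower game. As the backup
exceeds the lower Q-estimate by at most two bonuses, the lower value dominates the return for the
reduced rewards r - 2β‖φ‖_{Λ⁻¹}. -/
theorem PlaysEquilibria.value_sub_lower_le (hN : PlaysEquilibria G.H φ D (-1 * β) π ν)
    (hβ : 0 ≤ β) (hG : IsLinear G φ)
    (hB : BonusDominates G φ D β (estV G.H φ D (-1 * β) π ν)) (π₁ : Policy S A) (x : S) :
    value G π₁ ν 1 x - estV G.H φ D (-1 * β) π ν G.H x ≤
      2 * β * totalUncertainty G φ D π₁ ν x := by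
  have hφ := hG.measurable_feature
  have key : cumulative G π₁ ν (fun k z => G.reward k z + -(2 * β) * uncertainty φ D k z) 1 x ≤
      estV G.H φ D (-1 * β) π ν G.H x := by
    refine cumulative_le (v := fun h => estV G.H φ D (-1 * β) π ν (G.H + 1 - h))
      (hG.measurable_reward_add_mul_uncertainty _) (hG.abs_reward_add_mul_uncertainty_le _)
      (fun h hh => (hN.regular hβ hφ h hh).1) (fun h hh => (hN.regular hβ hφ h hh).2)
      (fun s => by simp [estV]) (fun h hh s => ?_) le_rfl (by omega) x
    simp only [Nat.add_sub_add_right]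
    rw [estV_step hh]
    refine le_trans (payoff_mono (fun a b => ?_) _ _) ((hN h hh s).1 (π₁.kernel h s) inferInstance)
    have := (hN.estQ_lower hβ hφ hB hh (s, a, b)).2
    linarith
  rw [hG.cumulative_reward_add_mul_uncertainty] at key
  rw [totalUncertainty_eq_cumulative]
  linarith

theorem PlaysEquilibria.upper_sub_value_le (hN : PlaysEquilibria G.H φ D (1 * β) π ν)
    (hβ : 0 ≤ β) (hG : IsLinear G φ)
    (hB : BonusDominates G φ D β (estV G.H φ D (1 * β) π ν)) (ν₁ : Policy S B) (x : S) :
    estV G.H φ D (1 * β) π ν G.H x - value G π ν₁ 1 x ≤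
      2 * β * totalUncertainty G φ D π ν₁ x := by
  have hφ := hG.measurable_feature
  have key : estV G.H φ D (1 * β) π ν G.H x ≤
      cumulative G π ν₁ (fun k z => G.reward k z + 2 * β * uncertainty φ D k z) 1 x := by
    refine le_cumulative (v := fun h => estV G.H φ D (1 * β) π ν (G.H + 1 - h))
      (hG.measurable_reward_add_mul_uncertainty _) (hG.abs_reward_add_mul_uncertainty_le _)
      (fun h hh => (hN.regular hβ hφ h hh).1) (fun h hh => (hN.regular hβ hφ h hh).2)
      (fun s => by simp [estV]) (fun h hh s => ?_) le_rfl (by omega) x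
    simp only [Nat.add_sub_add_right]
    rw [estV_step hh]
    refine ((hN h hh s).2 (ν₁.kernel h s) inferInstance).trans (payoff_mono (fun a b => ?_) _ _)
    have := (hN.estQ_upper hβ hφ hB hh (s, a, b)).2
    linarith
  rw [hG.cumulative_reward_add_mul_uncertainty] at key
  rw [totalUncertainty_eq_cumulative]
  linarith

/-- The duality gap of the output is at most the gap between the two estimated values. -/
theorem dualityGap_le_upper_sub_lower {ν' : Policy S B} {π' : Policy S A}
    (hlow : PlaysEquilibria G.H φ D (-1 * β) π ν') (hup : PlaysEquilibria G.H φ D (1 * β) π' ν)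
    (hβ : 0 ≤ β) (hφ : Measurable φ)
    (hBlow : BonusDominates G φ D β (estV G.H φ D (-1 * β) π ν'))
    (hBup : BonusDominates G φ D β (estV G.H φ D (1 * β) π' ν)) (x : S) :
    dualityGap G π ν x ≤
      estV G.H φ D (1 * β) π' ν G.H x - estV G.H φ D (-1 * β) π ν' G.H x := by
  have : Nonempty (Policy S A) := ⟨π⟩
  have : Nonempty (Policy S B) := ⟨ν⟩
  exact sub_le_sub (ciSup_le fun π₁ => hup.value_le_upper hβ hφ hBup π₁ x)
    (le_ciInf fun ν₁ => hlow.lower_le_value hβ hφ hBlow ν₁ x)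

theorem dualityGap_le {πhat π' πstar : Policy S A} {ν' νhat νstar : Policy S B}
    (hlow : PlaysEquilibria G.H φ D (-1 * β) πhat ν')
    (hup : PlaysEquilibria G.H φ D (1 * β) π' νhat)
    (hβ : 0 ≤ β) (hG : IsLinear G φ)
    (hBlow : BonusDominates G φ D β (estV G.H φ D (-1 * β) πhat ν'))
    (hBup : BonusDominates G φ D β (estV G.H φ D (1 * β) π' νhat))
    (hNash : IsNash G πstar νstar) (x : S) :
    dualityGap G πhat νhat x ≤ 2 * β * totalUncertainty G φ D πstar ν' x +
      2 * β * totalUncertainty G φ D π' νstar x := by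
  have h1 := dualityGap_le_upper_sub_lower hlow hup hβ hG.measurable_feature hBlow hBup x
  have h2 := hlow.value_sub_lower_le hβ hG hBlow πstar x
  have h3 := hup.upper_sub_value_le hβ hG hBup νstar x
  have h4 := hNash.value_le_value π' ν' x
  linarith

/-- After division by 4β > 0 the claim is a lower bound for an infimum over equilibria. If there is
no equilibrium the infimum is ⊤, and the same argument covers this case. -/
theorem dualityGap_le_relUncertainty {πhat π' : Policy S A} {ν' νhat : Policy S B}
    (hlow : PlaysEquilibria G.H φ D (-1 * β) πhat ν')
    (hup : PlaysEquilibria G.H φ D (1 * β) π' νhat)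
    (hβ : 0 < β) (hG : IsLinear G φ)
    (hBlow : BonusDominates G φ D β (estV G.H φ D (-1 * β) πhat ν'))
    (hBup : BonusDominates G φ D β (estV G.H φ D (1 * β) π' νhat)) (x : S) :
    (dualityGap G πhat νhat x : EReal) ≤ ((4 * β : ℝ) : EReal) * relUncertainty G φ D x := by
  have hpos : (0 : ℝ) < 4 * β := by positivity
  have key : ((dualityGap G πhat νhat x / (4 * β) : ℝ) : EReal) ≤ relUncertainty G φ D x := by
    refine le_iInf₂ fun p hp => EReal.coe_le_coe_iff.2 ?_
    rw [div_le_iff₀' hpos]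
    have h1 := dualityGap_le hlow hup hβ.le hG hBlow hBup hp x
    have h2 := hG.totalUncertainty_le_relUncertaintyOf D p.1 π' p.2 ν' x
    nlinarith [mul_le_mul_of_nonneg_left h2.1 hβ.le, mul_le_mul_of_nonneg_left h2.2 hβ.le]
  calc (dualityGap G πhat νhat x : EReal)
      = ((4 * β : ℝ) : EReal) * ((dualityGap G πhat νhat x / (4 * β) : ℝ) : EReal) := by
        rw [← EReal.coe_mul, mul_div_cancel₀ _ hpos.ne']
    _ ≤ _ := mul_le_mul_of_nonneg_left key (EReal.coe_nonneg.2 hpos.le)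

end Suboptimality

end ZeroSumMG

/-! ### The main theorem: choice of grid and confidence level -/

theorem theorem1 :
    ∃ c₀ : ℝ, 0 < c₀ ∧ ∀ c : ℝ, c₀ ≤ c →
      ∀ (S A B Ω : Type*) [MeasurableSpace S]
        [Fintype A] [Nonempty A] [MeasurableSpace A] [MeasurableSingletonClass A]
        [Fintype B] [Nonempty B] [MeasurableSpace B] [MeasurableSingletonClass B]
        [MeasurableSpace Ω] (Pr : Measure Ω) [IsProbabilityMeasure Pr]
        (G : ZeroSumMG.MarkovGame S A B) (d K : ℕ) (φ : S × A × B → Fin d → ℝ)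
        (D : Ω → ZeroSumMG.Dataset K S A B) (p β : ℝ),
        0 < K → 0 < p → p < 1 →
        ZeroSumMG.IsLinear G φ →
        ZeroSumMG.IsCompliant Pr G D →
        β = c * d * G.H * √(Real.log (2 * d * K * G.H / p)) →
        ∃ E : Set Ω, MeasurableSet E ∧ 1 - p ≤ Pr.real E ∧ ∀ ω ∈ E,
          ∀ (πhat π' : ZeroSumMG.Policy S A) (ν' νhat : ZeroSumMG.Policy S B),
            ZeroSumMG.IsPMVIRun G.H φ (D ω) β πhat ν' π' νhat →
            ∀ x : S,
              (∀ (πstar : ZeroSumMG.Policy S A) (νstar : ZeroSumMG.Policy S B),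
                ZeroSumMG.IsNash G πstar νstar →
                ZeroSumMG.dualityGap G πhat νhat x ≤
                  2 * β * ZeroSumMG.totalUncertainty G φ (D ω) πstar ν' x +
                  2 * β * ZeroSumMG.totalUncertainty G φ (D ω) π' νstar x) ∧
              (ZeroSumMG.dualityGap G πhat νhat x : EReal) ≤
                ((4 * β : ℝ) : EReal) * ZeroSumMG.relUncertainty G φ (D ω) x := by
  refine ⟨100, by norm_num, ?_⟩
  intro c hc S A B Ω _ _ _ _ _ _ _ _ _ _ Pr _ G d K φ D p β hK hp hp1 hG hD hβ
  -- For H = 0 the gap and β vanish. The second bound holds even if the relative uncertainty is ⊤,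
  -- since 0 · ⊤ = 0 in `EReal`.
  rcases Nat.eq_zero_or_pos G.H with hH | hH
  · refine ⟨Set.univ, MeasurableSet.univ, by simp [hp.le], fun ω _ πhat π' ν' νhat _ x => ?_⟩
    have hβ0 : β = 0 := by rw [hβ, hH]; simp
    rw [ZeroSumMG.dualityGap_eq_zero_of_horizon_eq_zero hH, hβ0]
    exact ⟨fun _ _ _ => by simp, by simp⟩
  have hd : 0 < d := by
    obtain ⟨ω⟩ : Nonempty Ω := nonempty_of_isProbabilityMeasure Pr
    exact hG.dim_pos hH ((D ω).state 1 ⟨0, hK⟩)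
  have hd' : (1 : ℝ) ≤ d := by exact_mod_cast hd
  have hK' : (1 : ℝ) ≤ K := by exact_mod_cast hK
  have hH' : (1 : ℝ) ≤ G.H := by exact_mod_cast hH
  have hζ : 1 < 2 * d * K * G.H / p := by
    rw [lt_div_iff₀ hp, one_mul]
    refine hp1.trans_le ?_
    have := one_le_mul_of_one_le_of_one_le (one_le_mul_of_one_le_of_one_le hd' hK') hH'
    linarith
  have hβ0 : 0 < β := by
    have := Real.sqrt_pos.2 (Real.log_pos hζ)
    rw [hβ]
    positivity
  set ε : ℝ := 1 / ((d : ℝ) * K) ^ 2 with hε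
  -- R bounds both the ridge weights, which are at most 2HK, and the entries of β²Λ⁻¹, which are at
  -- most β².
  set R : ℝ := 2 * G.H * K + β ^ 2 with hR
  have hε0 : 0 < ε := by positivity
  obtain ⟨N, hN1, hN2⟩ : ∃ N : ℕ, R / ε + 1 ≤ N ∧ (N : ℝ) ≤ R / ε + 2 :=
    ⟨⌈R / ε + 1⌉₊, Nat.le_ceil _, by
      have := (Nat.ceil_lt_add_one (by positivity : 0 ≤ R / ε + 1)).le
      linarith⟩
  -- Chosen so that the failure probability 2H(2N+1)^(d+d²) exp(-r) of the union bound equals p.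
  set r : ℝ := Real.log (2 * G.H * (2 * N + 1) ^ (d + d * d) / p) with hr
  obtain ⟨E, hE, hprob, hacc⟩ := hD.exists_accurate_event hG (by omega) ε N r
  have hle := ZeroSumMG.error_le_bonus hd hK hH hp hp1 hc hβ hε hR hN2 hr
  refine ⟨E, hE, ?_, fun ω hω πhat π' ν' νhat hrun x => ?_⟩
  · refine le_trans (le_of_eq ?_) hprob
    rw [hr, Real.exp_neg, Real.exp_log (by positivity)]
    field_simp
  · have hlow : ZeroSumMG.PlaysEquilibria G.H φ (D ω) (-1 * β) πhat ν' := by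
      rw [neg_one_mul]; exact hrun.lower
    have hup : ZeroSumMG.PlaysEquilibria G.H φ (D ω) (1 * β) π' νhat := by
      rw [one_mul]; exact hrun.upper
    have hBlow := (hacc ω hω).bonusDominates hG hε0 hβ0.le (by simp) hlow hN1 hle
    have hBup := (hacc ω hω).bonusDominates hG hε0 hβ0.le (by simp) hup hN1 hle
    exact ⟨fun πstar νstar hNash =>
        ZeroSumMG.dualityGap_le hlow hup hβ0.le hG hBlow hBup hNash x,
      ZeroSumMG.dualityGap_le_relUncertainty hlow hup hβ0 hG hBlow hBup x⟩
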